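/- Let $\Lambda\subseteq\mathbb R$ be open and let $(\rho_\lambda)_{\lambda\in\Lambda}$ be a family of qubit states $\rho_\lambda=\frac12(I+\omega_\lambda\cdot\hat\sigma)$, where $\hat\sigma$ is the tuple of Pauli matrices and the Bloch vector $\omega_\lambda\in\mathbb R^3$, $\|\omega_\lambda\|_2\le 1$, is continuously differentiable in $\lambda$. A quantum channel $\mathcal E$ (a completely positive trace-preserving linear map) on qubits belongs to $\mathrm{LDP}_\epsilon$ if $\operatorname{tr}(M\mathcal E(\rho))\le e^{\epsilon}\operatorname{tr}(M\mathcal E(\sigma))$ for all operators $0\preceq M\preceq I$ and all states $\rho,\sigma$. An estimator based on $N$ copies is a POVM on $(\mathbb C^2)^{\otimes N}$ (arbitrary collective measurements are allowed) followed by a real measurable function $\hat\lambda$ of its outcome. Fix $\lambda\in\Lambda$. The estimator is (locally) unbiased at $\lambda$ for the states $\mathcal E(\rho_\mu)^{\otimes N}$ if its mean $\mathbb E_\mu\hat\lambda$ exists for $\mu$ near $\lambda$ and is correct to first order at $\lambda$: $\mathbb E_\lambda\hat\lambda=\lambda$ and $\frac{d}{d\mu}\mathbb E_\mu\hat\lambda\big|_{\mu=\lambda}=1$.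 For $\alpha>0$ let $N_\alpha(\mathcal E)\in\mathbb N\cup\{\infty\}$ be the least $N$ for which some estimator based on $\mathcal E(\rho_\lambda)^{\otimes N}$ that is unbiased at $\lambda$ satisfies $\mathbb E_\lambda(\lambda-\hat\lambda)^2\le\alpha$ ($\infty$ if there is none). Assume that $\langle\partial_\lambda\omega_\lambda,\omega_\lambda\rangle\ne0$ at this $\lambda$. Then, for all $\alpha>0$ and $\epsilon>0$, $$\frac{C_1}{\alpha(e^\epsilon-1)^2}\;\le\;\inf_{\mathcal E\in\mathrm{LDP}_\epsilon}N_\alpha(\mathcal E)\;\le\;\left\lceil\frac{C_2(e^\epsilon+1)^2}{\alpha(e^\epsilon-1)^2}\right\rceil,$$ where $$C_1=\frac1{\|\partial_\lambda\omega_\lambda\|_2^2}\left(4+\frac14\,\frac{\|\partial_\lambda\omega_\lambda\|_2^2}{|\langle\partial_\lambda\omega_\lambda,\omega_\lambda\rangle|^2}\right)^{-1},\qquad C_2=\frac1{\|\partial_\lambda\omega_\lambda\|_2^2}.$$ In particular, the best-case sample complexity is $\Theta(\alpha^{-1}\epsilon^{-2})$ for small $\epsilon$: there are constants $c_1,c_2>0$,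 not depending on $\alpha$ and $\epsilon$, such that for every $\alpha>0$ there is $\epsilon_0>0$ with $c_1\alpha^{-1}\epsilon^{-2}\le\inf_{\mathcal E\in\mathrm{LDP}_\epsilon}N_\alpha(\mathcal E)\le c_2\alpha^{-1}\epsilon^{-2}$ for all $\epsilon\in(0,\epsilon_0)$. -/

import Mathlib

open MeasureTheory Matrix Filter Topology
open scoped ENNReal ComplexOrder

noncomputable section

namespace QuantumEstimation

/-! ### Density operators -/

/-- Density operators on the Hilbert space `ℂⁿ`: positive semidefinite matrices of trace one. -/
def DensityMatrix (n : Type) [Fintype n] : Type :=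
  {ρ : Matrix n n ℂ // ρ.PosSemidef ∧ ρ.trace = 1}

/-- A positive semidefinite matrix is a Gram matrix. -/
theorem exists_gram {n : Type} [Fintype n] {A : Matrix n n ℂ} (hA : A.PosSemidef) :
    ∃ B : Matrix n n ℂ, A = Bᴴ * B := by
  classical
  open scoped MatrixOrder in
  exact CStarAlgebra.nonneg_iff_eq_star_mul_self.mp (Matrix.nonneg_iff_posSemidef.mpr hA)

/-- The trace of a product of two positive semidefinite matrices is nonnegative. -/
theorem trace_mul_nonneg {n : Type} [Fintype n] {A B : Matrix n n ℂ} (hA : A.PosSemidef)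
    (hB : B.PosSemidef) : 0 ≤ (A * B).trace := by
  obtain ⟨C, rfl⟩ := exists_gram hB
  rw [← Matrix.mul_assoc, Matrix.trace_mul_comm, ← Matrix.mul_assoc]
  exact (hA.mul_mul_conjTranspose_same C).trace_nonneg

/-- The Pauli matrices `σ_x, σ_y, σ_z`, in the computational basis. -/
def pauli : Fin 3 → Matrix (Fin 2) (Fin 2) ℂ :=
  ![!![0, 1; 1, 0], !![0, -Complex.I; Complex.I, 0], !![1, 0; 0, -1]]

/-- The Bloch representation `(I + ω · σ) / 2` of a qubit operator. -/
def bloch (w : EuclideanSpace ℝ (Fin 3)) : Matrix (Fin 2) (Fin 2) ℂ :=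
  (1 / 2 : ℂ) • (1 + ∑ i, (w i : ℂ) • pauli i)

/-- The entries of `N` tensor copies `A ⊗ ⋯ ⊗ A` of a matrix, acting on `(ℂⁿ)^{⊗N}`, whose
computational basis is indexed by `Fin N → n`. -/
def tensorPower {n : Type} (A : Matrix n n ℂ) (N : ℕ) : Matrix (Fin N → n) (Fin N → n) ℂ :=
  Matrix.of fun i j => ∏ k, A (i k) (j k)

theorem tensorPower_posSemidef {n : Type} [Fintype n] {A : Matrix n n ℂ} (hA : A.PosSemidef)
    (N : ℕ) : (tensorPower A N).PosSemidef := by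
  classical
  obtain ⟨B, rfl⟩ := exists_gram hA
  have h : tensorPower (Bᴴ * B) N = (tensorPower B N)ᴴ * tensorPower B N := by
    ext i j
    simp [tensorPower, Matrix.mul_apply, Finset.prod_univ_sum, Finset.prod_mul_distrib]
  rw [h]
  exact Matrix.posSemidef_conjTranspose_mul_self _

theorem trace_tensorPower {n : Type} [Fintype n] (A : Matrix n n ℂ) (N : ℕ) :
    (tensorPower A N).trace = A.trace ^ N := by
  classical
  have h := (Finset.prod_univ_sum (fun _ : Fin N => (Finset.univ : Finset n))
    (fun _ a => A a a)).symm
  simpa [Matrix.trace, tensorPower] using h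

/-- The state `ρ^{⊗N}` of `N` independent copies of `ρ`. -/
def DensityMatrix.copies {n : Type} [Fintype n] [DecidableEq n] (ρ : DensityMatrix n) (N : ℕ) :
    DensityMatrix (Fin N → n) :=
  ⟨tensorPower ρ.1 N, tensorPower_posSemidef ρ.2.1 N, by rw [trace_tensorPower, ρ.2.2, one_pow]⟩

/-! ### Quantum channels and local differential privacy -/

/-- Quantum channels on `ℂⁿ`: completely positive and trace-preserving linear maps. Complete
positivity says that, for every `k`, applying the map to each block of a positive semidefinite
`k × k` block matrix gives a positive semidefinite matrix. -/
structure QuantumChannel (n : Type) [Fintype n] where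
  /-- The underlying linear map on operators. -/
  toLin : Matrix n n ℂ →ₗ[ℂ] Matrix n n ℂ
  completelyPositive : ∀ (k : ℕ) (X : Matrix (Fin k) (Fin k) (Matrix n n ℂ)),
    (Matrix.comp (Fin k) (Fin k) n n ℂ X).PosSemidef →
      (Matrix.comp (Fin k) (Fin k) n n ℂ (X.map toLin)).PosSemidef
  tracePreserving : ∀ X : Matrix n n ℂ, (toLin X).trace = X.trace

theorem QuantumChannel.map_posSemidef {n : Type} [Fintype n] (Φ : QuantumChannel n)
    {A : Matrix n n ℂ} (hA : A.PosSemidef) : (Φ.toLin A).PosSemidef := by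
  have h := Φ.completelyPositive 1 (Matrix.of fun _ _ => A) (hA.submatrix Prod.snd)
  exact h.submatrix (fun a : n => ((0 : Fin 1), a))

/-- The output state of a channel. -/
def QuantumChannel.apply {n : Type} [Fintype n] (Φ : QuantumChannel n) (ρ : DensityMatrix n) :
    DensityMatrix n :=
  ⟨Φ.toLin ρ.1, Φ.map_posSemidef ρ.2.1, by rw [Φ.tracePreserving, ρ.2.2]⟩

/-- The set of `ε`-locally differentially private channels: `tr (M Φ(ρ)) ≤ e^ε tr (M Φ(σ))` for
all operators `0 ≤ M ≤ I` and all states `ρ`, `σ` (these traces are real). -/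
def LDP (n : Type) [Fintype n] [DecidableEq n] (ε : ℝ) : Set (QuantumChannel n) :=
  {Φ | ∀ M : Matrix n n ℂ, M.PosSemidef → (1 - M).PosSemidef → ∀ ρ σ : DensityMatrix n,
    (M * (Φ.apply ρ).1).trace.re ≤ Real.exp ε * (M * (Φ.apply σ).1).trace.re}

/-! ### Measurements and estimators -/

/-- Positive operator-valued measures on `ℂⁿ` with outcomes in a measurable space `Ω`: σ-additive,
with positive semidefinite values and total mass `I`. -/
structure POVM (n : Type) [Fintype n] [DecidableEq n] (Ω : Type) [MeasurableSpace Ω] where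
  /-- The effect of each event. -/
  effect : VectorMeasure Ω (Matrix n n ℂ)
  posSemidef : ∀ S, (effect S).PosSemidef
  total : effect Set.univ = 1

/-- The distribution of the outcome of a measurement (Born rule):
the event `S` has probability `tr (M(S) ρ)`. -/
def POVM.law {n : Type} [Fintype n] [DecidableEq n] {Ω : Type} [MeasurableSpace Ω]
    (M : POVM n Ω) (ρ : DensityMatrix n) : Measure Ω :=
  Measure.ofMeasurable (fun S _ => ENNReal.ofReal (M.effect S * ρ.1).trace.re) (by simp) (by
    intro f hf hd
    have h := M.effect.m_iUnion hf hd
    have h2 : HasSum (fun i => (M.effect (f i) * ρ.1).trace.re)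
        (M.effect (⋃ i, f i) * ρ.1).trace.re := by
      have hc : Continuous fun A : Matrix n n ℂ => (A * ρ.1).trace.re := by fun_prop
      exact h.map (⟨⟨fun A : Matrix n n ℂ => (A * ρ.1).trace.re, by simp⟩,
        fun A B => by simp [Matrix.add_mul]⟩ : Matrix n n ℂ →+ ℝ) hc
    rw [← h2.tsum_eq, ENNReal.ofReal_tsum_of_nonneg _ h2.summable]
    intro i
    exact (Complex.le_def.mp (trace_mul_nonneg (M.posSemidef (f i)) ρ.2.1)).1)

theorem POVM.law_apply {n : Type} [Fintype n] [DecidableEq n] {Ω : Type} [MeasurableSpace Ω]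
    (M : POVM n Ω) (ρ : DensityMatrix n) {S : Set Ω} (hS : MeasurableSet S) :
    M.law ρ S = ENNReal.ofReal (M.effect S * ρ.1).trace.re :=
  Measure.ofMeasurable_apply S hS

/-- An estimator of a real parameter from a system `ℂⁿ`: a measurement, followed by a measurable
real function of its outcome. -/
structure Estimator (n : Type) [Fintype n] [DecidableEq n] where
  /-- The space of measurement outcomes. -/
  Outcome : Type
  /-- Its σ-algebra. -/
  [meas : MeasurableSpace Outcome]
  /-- The measurement. -/
  povm : POVM n Outcome
  /-- The value of the estimate for each outcome. -/
  estimate : Outcome → ℝ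
  measurable_estimate : Measurable estimate

/-- The distribution of the measurement outcome when the system is in state `ρ`. -/
def Estimator.law {n : Type} [Fintype n] [DecidableEq n] (T : Estimator n)
    (ρ : DensityMatrix n) : @Measure T.Outcome T.meas :=
  letI := T.meas
  T.povm.law ρ

/-- The estimate has a finite mean in the state `ρ`. -/
def Estimator.HasMean {n : Type} [Fintype n] [DecidableEq n] (T : Estimator n)
    (ρ : DensityMatrix n) : Prop :=
  letI := T.meas
  Integrable T.estimate (T.law ρ)

/-- The mean of the estimate in the state `ρ`. -/
def Estimator.mean {n : Type} [Fintype n] [DecidableEq n] (T : Estimator n)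
    (ρ : DensityMatrix n) : ℝ :=
  letI := T.meas
  ∫ x, T.estimate x ∂(T.law ρ)

/-- The mean square `𝔼 (l - estimate)²` of the estimation error in the state `ρ`. -/
def Estimator.meanSquareError {n : Type} [Fintype n] [DecidableEq n] (T : Estimator n)
    (ρ : DensityMatrix n) (l : ℝ) : ℝ≥0∞ :=
  letI := T.meas
  ∫⁻ x, ENNReal.ofReal ((l - T.estimate x) ^ 2) ∂(T.law ρ)

/-- `T` is an unbiased estimator of the parameter of the family `ρ` at the parameter value `l`, in
the (local) sense of the quantum Cramér–Rao theory: its mean is correct to first order at `l`. -/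
def Estimator.IsUnbiasedAt {n : Type} [Fintype n] [DecidableEq n] (T : Estimator n)
    (ρ : ℝ → DensityMatrix n) (l : ℝ) : Prop :=
  (∀ᶠ m in 𝓝 l, T.HasMean (ρ m)) ∧ T.mean (ρ l) = l ∧ HasDerivAt (fun m => T.mean (ρ m)) 1 l

/-- The sample complexity `N_α(Φ)` at the parameter value `l`: the least number `N` of copies such
that some unbiased estimator based on `Φ(ρ_l)^{⊗N}` has error variance at most `α`; it is `⊤` if
there is none. (No estimator based on `N = 0` copies is unbiased.) -/
def sampleComplexity {n : Type} [Fintype n] [DecidableEq n] (ρ : ℝ → DensityMatrix n) (l α : ℝ)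
    (Φ : QuantumChannel n) : ℕ∞ :=
  ⨅ (N : ℕ) (_ : ∃ T : Estimator (Fin N → n),
    T.IsUnbiasedAt (fun m => (Φ.apply (ρ m)).copies N) l ∧
      T.meanSquareError ((Φ.apply (ρ l)).copies N) l ≤ ENNReal.ofReal α), (N : ℕ∞)

/-- The best-case sample complexity `inf {N_α(Φ) : Φ ∈ LDP_ε}`. -/
def bestSampleComplexity {n : Type} [Fintype n] [DecidableEq n] (ρ : ℝ → DensityMatrix n)
    (l α ε : ℝ) : ℕ∞ :=
  ⨅ Φ ∈ LDP n ε, sampleComplexity ρ l α Φ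

/-- The constant `C₁` for a Bloch vector `w` with derivative `w'`. -/
def C₁ (w w' : EuclideanSpace ℝ (Fin 3)) : ℝ :=
  1 / ‖w'‖ ^ 2 * (4 + 1 / 4 * (‖w'‖ ^ 2 / |inner ℝ w' w| ^ 2))⁻¹

/-- The constant `C₂` for a Bloch vector with derivative `w'`. -/
def C₂ (w' : EuclideanSpace ℝ (Fin 3)) : ℝ :=
  1 / ‖w'‖ ^ 2

end QuantumEstimation

end

namespace QuantumEstimation

/-! ### Products of matrices -/

/-! Write `E = e^ε`.

Lower bound. Privacy, tested on rank-one projections, says that any two output states satisfy `Φ(ρ)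
≤ E Φ(σ)`. A difference of Bloch vectors of length `d` is `d / 2` times the difference of two
antipodal pure states, so `X = Φ(ρ₂) - Φ(ρ₁)` lies between `-k Φ(ρ₁)` and `k Φ(ρ₁)` with `k = d (E -
1)` (`posSemidef_smul_apply_sub`). Hence `X = σ R` with `σ = Φ(ρ₁)` and `tr (Rᴴ σ R) ≤ k²`
(`exists_mul_eq_of_posSemidef`); this trace is a quantum χ²-divergence. One plus the divergence is
multiplicative over copies, so `N` copies have divergence at most `(1 + k²)^N - 1`. The
Hammersley–Chapman–Robbins inequality bounds the squared shift of the mean by the variance times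
this divergence, for any collective measurement (`Estimator.sq_mean_copies_sub_le`). Dividing by the
squared parameter shift and letting it tend to zero gives `1 ≤ α N ‖ω'‖² (E - 1)²`
(`Estimator.IsUnbiasedAt.one_le`). Finite differences need no differentiation under the integral.
The resulting constant `1 / ‖ω'‖²` is at least `C₁`.

Upper bound. The depolarizing channel with `p = (E - 1) / (E + 1)` is private and contracts Bloch
vectors by `p`. Measuring the spin of each copy along `ω' / ‖ω'‖`, averaging, and rescaling by `1 /
(p ‖ω'‖)` gives a locally unbiased estimator of variance at most `1 / (N p² ‖ω'‖²)`
(`bestSampleComplexity_le`). -/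

theorem tensorPower_mul {n : Type} [Fintype n] (A B : Matrix n n ℂ) (N : ℕ) :
    tensorPower (A * B) N = tensorPower A N * tensorPower B N := by
  classical
  ext i j
  simp [tensorPower, Matrix.mul_apply, Finset.prod_univ_sum, Finset.prod_mul_distrib]

theorem tensorPower_conjTranspose {n : Type} (A : Matrix n n ℂ) (N : ℕ) :
    tensorPower Aᴴ N = (tensorPower A N)ᴴ := by
  ext i j
  simp [tensorPower]

/-- A quadratic inequality between traces, expressing positivity of `(c - R)ᴴ τ (c - R)`. -/
theorem two_mul_trace_le {n : Type} [Fintype n] [DecidableEq n] {M τ R : Matrix n n ℂ}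
    (hM : M.PosSemidef) (hτ : τ.PosSemidef) (c : ℝ) :
    2 * c * (M * (τ * R)).trace.re ≤
      c ^ 2 * (M * τ).trace.re + (M * (Rᴴ * τ * R)).trace.re := by
  have h := (Complex.le_def.mp (trace_mul_nonneg hM
    (hτ.conjTranspose_mul_mul_same ((c : ℂ) • (1 : Matrix n n ℂ) - R)))).1
  have hs : (M * (Rᴴ * τ)).trace.re = (M * (τ * R)).trace.re := by
    have : (M * (τ * R))ᴴ.trace = (M * (Rᴴ * τ)).trace := by
      rw [conjTranspose_mul, conjTranspose_mul, hM.isHermitian.eq, hτ.isHermitian.eq,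
        trace_mul_comm]
    rw [← this, trace_conjTranspose]
    simp
  have he : M * (((c : ℂ) • (1 : Matrix n n ℂ) - R)ᴴ * τ * ((c : ℂ) • (1 : Matrix n n ℂ) - R)) =
      ((c ^ 2 : ℝ) : ℂ) • (M * τ) - (c : ℂ) • (M * (τ * R)) - (c : ℂ) • (M * (Rᴴ * τ))
        + M * (Rᴴ * τ * R) := by
    simp only [conjTranspose_sub, conjTranspose_smul, conjTranspose_one, Matrix.sub_mul,
      Matrix.mul_sub, Matrix.smul_mul, Matrix.mul_smul, Matrix.one_mul, Matrix.mul_one,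
      Complex.star_def, Complex.conj_ofReal, smul_sub, smul_smul, Matrix.mul_assoc]
    push_cast
    rw [pow_two]
    abel
  rw [he] at h
  simp only [trace_add, trace_sub, trace_smul, smul_eq_mul, Complex.add_re, Complex.sub_re,
    Complex.re_ofReal_mul, Complex.zero_re, hs] at h
  linarith

/-- If `-k σ ≤ X ≤ k σ` with `σ` invertible, then `tr (X σ⁻¹ X) ≤ k² tr σ`. -/
theorem trace_mul_inv_mul_le {n : Type} [Fintype n] [DecidableEq n] {σ X : Matrix n n ℂ} {k : ℝ}
    (hk : 0 < k) (hσ : σ.PosDef) (h₁ : ((k : ℂ) • σ - X).PosSemidef)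
    (h₂ : ((k : ℂ) • σ + X).PosSemidef) :
    (X * σ⁻¹ * X).trace.re ≤ k ^ 2 * σ.trace.re := by
  set A := (k : ℂ) • σ - X
  set B := (k : ℂ) • σ + X
  have hdet : IsUnit σ.det := hσ.isUnit.map Matrix.detMonoidHom
  have e1 : σ * σ⁻¹ = 1 := Matrix.mul_nonsing_inv _ hdet
  have e2 : σ⁻¹ * σ = 1 := Matrix.nonsing_inv_mul _ hdet
  have hS : σ⁻¹ᴴ = σ⁻¹ := hσ.inv.isHermitian.eq
  -- The expression `A σ⁻¹ B` is symmetric in `A` and `B`. Inserting `A + B = 2 k σ` therefore turns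
  -- it into a sum of congruences of `A` and of `B`, whose trace is nonnegative.
  have hAB : A * σ⁻¹ * B = ((k ^ 2 : ℝ) : ℂ) • σ - X * σ⁻¹ * X := by
    simp only [A, B, Matrix.sub_mul, Matrix.mul_add, Matrix.smul_mul, Matrix.mul_smul, e1,
      Matrix.one_mul, smul_smul, Matrix.mul_assoc, e2, Matrix.mul_one, smul_sub]
    push_cast
    rw [pow_two]
    abel
  have hBA : A * σ⁻¹ * B = B * σ⁻¹ * A := by
    rw [hAB]
    simp only [A, B, Matrix.add_mul, Matrix.mul_sub, Matrix.smul_mul, Matrix.mul_smul, e1,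
      Matrix.one_mul, smul_smul, Matrix.mul_assoc, e2, Matrix.mul_one, smul_add]
    push_cast
    rw [pow_two]
    abel
  have hsum : A + B = ((2 * k : ℝ) : ℂ) • σ := by
    simp only [A, B]; push_cast; rw [mul_smul, two_smul]; abel
  have hkey : ((2 * k : ℝ) : ℂ) • (A * σ⁻¹ * B) =
      (σ⁻¹ * A)ᴴ * B * (σ⁻¹ * A) + (σ⁻¹ * B)ᴴ * A * (σ⁻¹ * B) := by
    have e3 : ((2 * k : ℝ) : ℂ) • (A * σ⁻¹ * B) = A * σ⁻¹ * (A + B) * (σ⁻¹ * B) := by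
      rw [hsum, Matrix.mul_smul, Matrix.smul_mul, Matrix.mul_assoc A σ⁻¹ σ, e2, Matrix.mul_one,
        ← Matrix.mul_assoc]
    rw [e3, conjTranspose_mul, conjTranspose_mul, hS, h₁.isHermitian.eq, h₂.isHermitian.eq,
      Matrix.mul_add, Matrix.add_mul]
    have e4 : A * σ⁻¹ * A * (σ⁻¹ * B) = A * σ⁻¹ * B * (σ⁻¹ * A) := by
      calc _ = A * σ⁻¹ * (A * σ⁻¹ * B) := by simp only [Matrix.mul_assoc]
        _ = A * σ⁻¹ * (B * σ⁻¹ * A) := by rw [hBA]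
        _ = _ := by simp only [Matrix.mul_assoc]
    rw [e4]
    congr 2
  have hpos : 0 ≤ (2 * k) * (A * σ⁻¹ * B).trace.re := by
    have := (Complex.le_def.mp ((h₂.conjTranspose_mul_mul_same (σ⁻¹ * A)).add
      (h₁.conjTranspose_mul_mul_same (σ⁻¹ * B))).trace_nonneg).1
    rw [← hkey, trace_smul, smul_eq_mul, Complex.re_ofReal_mul] at this
    simpa using this
  have := nonneg_of_mul_nonneg_right hpos (by positivity)
  rw [hAB, trace_sub, trace_smul, smul_eq_mul, Complex.sub_re, Complex.re_ofReal_mul] at this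
  linarith

/-- A traceless Hermitian `2 × 2` matrix with nontrivial kernel vanishes. -/
theorem eq_zero_of_trace_eq_zero_of_det_eq_zero {X : Matrix (Fin 2) (Fin 2) ℂ}
    (hX : X.IsHermitian) (ht : X.trace = 0) (hd : X.det = 0) : X = 0 := by
  -- Cayley–Hamilton: `X² = (tr X) X - det X = 0`.
  have h : Xᴴ * X = 0 := by
    rw [hX.eq]
    rw [trace_fin_two] at ht
    rw [det_fin_two] at hd
    have h1 : X 1 1 = - X 0 0 := by linear_combination ht
    rw [h1] at hd
    ext i j
    fin_cases i <;> fin_cases j <;> simp [Matrix.mul_apply, Fin.sum_univ_two, h1] <;>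
      first | ring1 | linear_combination -hd
  exact Matrix.conjTranspose_mul_self_eq_zero.mp h

/-- A perturbation `X` of a qubit state `σ` with `-k σ ≤ X ≤ k σ` has the form `σ R`, where the
"norm" `tr (Rᴴ σ R)` is at most `k²`. -/
theorem exists_mul_eq_of_posSemidef {σ X : Matrix (Fin 2) (Fin 2) ℂ} {k : ℝ}
    (hk : 0 < k) (hσ : σ.PosSemidef) (hσt : σ.trace = 1) (hX : X.trace = 0)
    (h₁ : ((k : ℂ) • σ - X).PosSemidef) (h₂ : ((k : ℂ) • σ + X).PosSemidef) :
    ∃ R : Matrix (Fin 2) (Fin 2) ℂ, σ * R = X ∧ (Rᴴ * σ * R).trace.re ≤ k ^ 2 := by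
  have hXh : X.IsHermitian := by
    have h := h₂.isHermitian.sub h₁.isHermitian
    have e : (k : ℂ) • σ + X - ((k : ℂ) • σ - X) = (2 : ℂ) • X := by rw [two_smul]; abel
    rw [e] at h
    have h' := h.eq
    rw [conjTranspose_smul] at h'
    have : (2 : ℂ) • Xᴴ = (2 : ℂ) • X := by simpa using h'
    exact smul_right_injective _ (two_ne_zero) this
  by_cases hd : σ.det = 0
  -- If `σ` is singular, both bounds force the quadratic form of `X` to vanish on the kernel vector
  -- `u`, and then `X u = 0`. In dimension two a traceless Hermitian `X` with a kernel is zero, so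
  -- `R = 0` serves.
  · obtain ⟨u, hu, hu0⟩ := Matrix.exists_mulVec_eq_zero_iff.mpr hd
    have q1 := h₁.dotProduct_mulVec_nonneg u
    have q2 := h₂.dotProduct_mulVec_nonneg u
    simp only [Matrix.sub_mulVec, Matrix.add_mulVec, Matrix.smul_mulVec, hu0, smul_zero, zero_sub,
      zero_add, dotProduct_neg] at q1 q2
    have q : star u ⬝ᵥ (X *ᵥ u) = 0 := le_antisymm (neg_nonneg.mp q1) q2
    have hq : ((k : ℂ) • σ + X) *ᵥ u = 0 := by
      rw [← h₂.dotProduct_mulVec_zero_iff]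
      rw [Matrix.add_mulVec, Matrix.smul_mulVec, hu0, smul_zero, zero_add, q]
    have hXu : X *ᵥ u = 0 := by simpa [Matrix.add_mulVec, Matrix.smul_mulVec, hu0] using hq
    have hX0 : X = 0 := eq_zero_of_trace_eq_zero_of_det_eq_zero hXh hX
      (Matrix.exists_mulVec_eq_zero_iff.mp ⟨u, hu, hXu⟩)
    exact ⟨0, by simp [hX0], by simp; positivity⟩
  · have hdu : IsUnit σ.det := isUnit_iff_ne_zero.mpr hd
    have hpd : σ.PosDef := hσ.posDef_iff_isUnit.mpr ((Matrix.isUnit_iff_isUnit_det _).mpr hdu)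
    refine ⟨σ⁻¹ * X, by rw [← Matrix.mul_assoc, Matrix.mul_nonsing_inv _ hdu, Matrix.one_mul], ?_⟩
    have h := trace_mul_inv_mul_le hk hpd h₁ h₂
    rw [hσt, Complex.one_re, mul_one] at h
    rwa [conjTranspose_mul, hpd.inv.isHermitian.eq, hXh.eq, Matrix.mul_assoc,
      ← Matrix.mul_assoc σ, Matrix.mul_nonsing_inv _ hdu, Matrix.one_mul]

/-! ### The classical Hammersley–Chapman–Robbins inequality -/

/-- An additive set function summed over the level sets of a simple function. -/
theorem sum_preimage_singleton {Ω : Type} [MeasurableSpace Ω] (Q : SignedMeasure Ω)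
    (φ : SimpleFunc Ω ℝ) : ∑ y ∈ φ.range, Q (φ ⁻¹' {y}) = Q Set.univ := by
  rw [← VectorMeasure.of_biUnion_finset (v := Q) (s := φ.range) (f := fun y => φ ⁻¹' {y})]
  · congr 1
    ext x
    simp
  · intro a _ b _ hab
    exact Disjoint.preimage _ (by simpa using hab)
  · intro y _
    exact φ.measurableSet_preimage _

/-- A pointwise quadratic bound for the difference of two measures integrates. -/
theorem two_mul_integral_sub_integral_le {Ω : Type} [MeasurableSpace Ω] {P P' : Measure Ω}
    [IsFiniteMeasure P] [IsFiniteMeasure P'] (Q : SignedMeasure Ω)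
    (h : ∀ S, MeasurableSet S → ∀ c : ℝ,
      2 * c * (P'.real S - P.real S) ≤ c ^ 2 * P.real S + Q S)
    {f : Ω → ℝ} (hf : Measurable f) (hP : Integrable f P) (hP' : Integrable f P')
    (hf2 : Integrable (fun x => f x ^ 2) P) :
    2 * (∫ x, f x ∂P' - ∫ x, f x ∂P) ≤ ∫ x, f x ^ 2 ∂P + Q Set.univ := by
  have hs : ∀ φ : SimpleFunc Ω ℝ,
      2 * (∫ x, φ x ∂P' - ∫ x, φ x ∂P) ≤ ∫ x, φ x ^ 2 ∂P + Q Set.univ := by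
    intro φ
    have i : ∀ (μ : Measure Ω) [IsFiniteMeasure μ] (g : ℝ → ℝ), g 0 = 0 →
        ∫ x, g (φ x) ∂μ = ∑ y ∈ φ.range, g y * μ.real (φ ⁻¹' {y}) := by
      intro μ _ g hg
      have e := SimpleFunc.map_integral φ g (φ.integrable_of_isFiniteMeasure (μ := μ)) hg
      rw [SimpleFunc.integral_eq_integral _ (SimpleFunc.integrable_of_isFiniteMeasure _)] at e
      simpa [mul_comm] using e
    have i1 := i P id rfl
    have i2 := i P' id rfl
    have i3 := i P (fun y => y ^ 2) (by simp)
    simp only [id] at i1 i2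
    rw [i1, i2, i3, ← sum_preimage_singleton Q φ, ← Finset.sum_sub_distrib, Finset.mul_sum,
      ← Finset.sum_add_distrib]
    refine Finset.sum_le_sum fun y _ => ?_
    -- On each level set the free constant `c` is the value `y` of the simple function.
    have := h _ (φ.measurableSet_preimage {y}) y
    linarith
  let φ : ℕ → SimpleFunc Ω ℝ := fun k => SimpleFunc.approxOn f hf Set.univ 0 (by simp) k
  have hb : ∀ k x, ‖φ k x‖ ≤ 2 * ‖f x‖ := fun k x => by
    have := SimpleFunc.norm_approxOn_zero_le hf (s := Set.univ) (by simp) x k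
    simp only [φ]; linarith
  have hl : ∀ x, Tendsto (fun k => φ k x) atTop (𝓝 (f x)) := fun x =>
    SimpleFunc.tendsto_approxOn hf (by simp) (by simp)
  have t1 : Tendsto (fun k => ∫ x, φ k x ∂P) atTop (𝓝 (∫ x, f x ∂P)) :=
    tendsto_integral_of_dominated_convergence _ (fun k => (φ k).aestronglyMeasurable)
      (hP.norm.const_mul 2) (fun k => ae_of_all _ (hb k)) (ae_of_all _ hl)
  have t2 : Tendsto (fun k => ∫ x, φ k x ∂P') atTop (𝓝 (∫ x, f x ∂P')) :=
    tendsto_integral_of_dominated_convergence _ (fun k => (φ k).aestronglyMeasurable)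
      (hP'.norm.const_mul 2) (fun k => ae_of_all _ (hb k)) (ae_of_all _ hl)
  have t3 : Tendsto (fun k => ∫ x, φ k x ^ 2 ∂P) atTop (𝓝 (∫ x, f x ^ 2 ∂P)) := by
    refine tendsto_integral_of_dominated_convergence _
      (fun k => ((φ k).measurable.pow_const 2).aestronglyMeasurable)
      (hf2.const_mul 4) (fun k => ae_of_all _ fun x => ?_) (ae_of_all _ fun x => (hl x).pow 2)
    have := pow_le_pow_left₀ (norm_nonneg _) (hb k x) 2
    rw [norm_pow]
    refine this.trans (le_of_eq ?_)
    rw [mul_pow, Real.norm_eq_abs, sq_abs]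
    norm_num
  exact le_of_tendsto_of_tendsto' ((t2.sub t1).const_mul 2) (t3.add_const _) fun k => hs (φ k)

/-- The Hammersley–Chapman–Robbins inequality. -/
theorem sq_integral_sub_integral_le {Ω : Type} [MeasurableSpace Ω] {P P' : Measure Ω}
    [IsFiniteMeasure P] [IsFiniteMeasure P'] (Q : SignedMeasure Ω)
    (h : ∀ S, MeasurableSet S → ∀ c : ℝ,
      2 * c * (P'.real S - P.real S) ≤ c ^ 2 * P.real S + Q S)
    {f : Ω → ℝ} (hf : Measurable f) (hP : Integrable f P) (hP' : Integrable f P')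
    (hf2 : Integrable (fun x => f x ^ 2) P) :
    (∫ x, f x ∂P' - ∫ x, f x ∂P) ^ 2 ≤ (∫ x, f x ^ 2 ∂P) * Q Set.univ := by
  -- Scaling `f` by `s` gives a quadratic polynomial in `s` that is never negative; its discriminant
  -- yields the claim.
  have hs : ∀ s : ℝ, 0 ≤ (∫ x, f x ^ 2 ∂P) * (s * s) +
      (-2 * (∫ x, f x ∂P' - ∫ x, f x ∂P)) * s + Q Set.univ := by
    intro s
    have hq := two_mul_integral_sub_integral_le Q h (hf.const_mul s) (hP.const_mul s)
      (hP'.const_mul s) (by simpa only [mul_pow] using hf2.const_mul (s ^ 2))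
    simp only [mul_pow, integral_const_mul] at hq
    nlinarith
  have := discrim_le_zero hs
  rw [discrim] at this
  linarith

/-! ### Consequences of privacy -/

theorem trace_vecMulVec_star_mul {n : Type} [Fintype n] (A : Matrix n n ℂ) (x : n → ℂ) :
    (vecMulVec x (star x) * A).trace = star x ⬝ᵥ (A *ᵥ x) := by
  rw [vecMulVec_mul, trace_vecMulVec, dotProduct_comm, dotProduct_mulVec]

/-- The output states of a private channel dominate one another. -/
theorem posSemidef_exp_smul_sub {n : Type} [Fintype n] [DecidableEq n] {ε : ℝ}
    {Φ : QuantumChannel n} (hΦ : Φ ∈ LDP n ε) (ρ σ : DensityMatrix n) :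
    (((Real.exp ε : ℝ) : ℂ) • (Φ.apply σ).1 - (Φ.apply ρ).1).PosSemidef := by
  have hherm : (((Real.exp ε : ℝ) : ℂ) • (Φ.apply σ).1 - (Φ.apply ρ).1).IsHermitian :=
    ((Φ.apply σ).2.1.smul (a := ((Real.exp ε : ℝ) : ℂ))
      (by exact_mod_cast (Real.exp_pos ε).le)).isHermitian.sub (Φ.apply ρ).2.1.isHermitian
  refine PosSemidef.of_dotProduct_mulVec_nonneg hherm fun x => ?_
  by_cases hx : x = 0
  · simp [hx]
  have hpos : 0 < star x ⬝ᵥ x := dotProduct_star_self_pos_iff.mpr hx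
  obtain ⟨r, hr, hrx⟩ : ∃ r : ℝ, 0 < r ∧ (r : ℂ) = star x ⬝ᵥ x := by
    have h := Complex.lt_def.mp hpos
    exact ⟨(star x ⬝ᵥ x).re, h.1, Complex.ext rfl (by simpa using h.2)⟩
  -- The test operator is `V / r`, the orthogonal projection onto the line of `x`; privacy for it is
  -- the quadratic form inequality at `x`.
  set V := vecMulVec x (star x)
  have hVV : V * V = (r : ℂ) • V := by
    simp only [V]
    rw [vecMulVec_mul_vecMulVec, hrx, vecMulVec_smul]
  have hV : V.PosSemidef := posSemidef_vecMulVec_self_star x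
  have hrr : ((r⁻¹ : ℝ) : ℂ) * (r : ℂ) = 1 := by
    rw [← Complex.ofReal_mul, inv_mul_cancel₀ hr.ne', Complex.ofReal_one]
  have hM : (((r⁻¹ : ℝ) : ℂ) • V).PosSemidef :=
    hV.smul (by exact_mod_cast (inv_pos.mpr hr).le)
  have hM1 : (1 - ((r⁻¹ : ℝ) : ℂ) • V).PosSemidef := by
    have h := posSemidef_conjTranspose_mul_self (1 - ((r⁻¹ : ℝ) : ℂ) • V)
    rw [conjTranspose_sub, conjTranspose_one, hM.isHermitian.eq] at h
    have e : (1 - ((r⁻¹ : ℝ) : ℂ) • V) * (1 - ((r⁻¹ : ℝ) : ℂ) • V) = 1 - ((r⁻¹ : ℝ) : ℂ) • V := by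
      rw [Matrix.sub_mul, Matrix.one_mul, Matrix.mul_sub, Matrix.mul_one, Matrix.smul_mul,
        Matrix.mul_smul, hVV, smul_smul ((r⁻¹ : ℝ) : ℂ) (r : ℂ), hrr, one_smul,
        sub_self, sub_zero]
    rwa [e] at h
  have h := hΦ _ hM hM1 ρ σ
  simp only [Matrix.smul_mul, trace_smul, smul_eq_mul, Complex.re_ofReal_mul, V,
    trace_vecMulVec_star_mul] at h
  have h' : (star x ⬝ᵥ ((Φ.apply ρ).1 *ᵥ x)).re ≤
      Real.exp ε * (star x ⬝ᵥ ((Φ.apply σ).1 *ᵥ x)).re := by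
    rw [mul_left_comm] at h
    exact le_of_mul_le_mul_left h (inv_pos.mpr hr)
  have him := hherm.im_star_dotProduct_mulVec_self x
  rw [Complex.le_def]
  refine ⟨?_, by simpa using him.symm⟩
  simp only [Matrix.sub_mulVec, Matrix.smul_mulVec, dotProduct_sub, dotProduct_smul, smul_eq_mul,
    Complex.sub_re, Complex.re_ofReal_mul, Complex.zero_re]
  linarith

/-- The difference of two output states of a private channel is dominated by any output state. -/
theorem posSemidef_smul_sub_sub {n : Type} [Fintype n] [DecidableEq n] {ε : ℝ}
    {Φ : QuantumChannel n} (hΦ : Φ ∈ LDP n ε) (σ τ₁ τ₂ : DensityMatrix n) :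
    (((2 * (Real.exp ε - 1) : ℝ) : ℂ) • (Φ.apply σ).1 -
      ((Φ.apply τ₁).1 - (Φ.apply τ₂).1)).PosSemidef := by
  set E := Real.exp ε
  have hE : 0 < E := Real.exp_pos ε
  have h1 := posSemidef_exp_smul_sub hΦ τ₁ σ
  have h2 := (posSemidef_exp_smul_sub hΦ σ τ₂).smul (a := ((E⁻¹ : ℝ) : ℂ))
    (by exact_mod_cast (inv_pos.mpr hE).le)
  -- The first two bounds give the constant `E - E⁻¹`. The slack up to `2 (E - 1)` is exactly `(E -
  -- 1)² / E ≥ 0`.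
  have h3 := (Φ.apply σ).2.1.smul (a := (((E - 1) ^ 2 / E : ℝ) : ℂ))
    (by exact_mod_cast (by positivity : (0 : ℝ) ≤ (E - 1) ^ 2 / E))
  convert (h1.add h2).add h3 using 1
  have hE' : (E : ℂ) ≠ 0 := by exact_mod_cast hE.ne'
  change _ = (E : ℂ) • _ - _ + ((E⁻¹ : ℝ) : ℂ) • ((E : ℂ) • _ - _) + _
  rw [smul_sub, smul_smul]
  have e1 : ((E⁻¹ : ℝ) : ℂ) * (E : ℂ) = 1 := by push_cast; field_simp
  have e2 : ((2 * (E - 1) : ℝ) : ℂ) = E - ((E⁻¹ : ℝ) : ℂ) + (((E - 1) ^ 2 / E : ℝ) : ℂ) := by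
    push_cast; field_simp; ring
  rw [e1, e2, one_smul, add_smul, sub_smul]
  abel

/-! ### Pure qubit states -/

theorem bloch_eq (w : EuclideanSpace ℝ (Fin 3)) :
    bloch w = !![(1 + (w 2 : ℂ)) / 2, ((w 0 : ℂ) - w 1 * Complex.I) / 2;
      ((w 0 : ℂ) + w 1 * Complex.I) / 2, (1 - (w 2 : ℂ)) / 2] := by
  ext i j
  fin_cases i <;> fin_cases j <;> simp [bloch, pauli, Fin.sum_univ_three] <;> ring

theorem trace_bloch (w : EuclideanSpace ℝ (Fin 3)) : (bloch w).trace = 1 := by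
  rw [bloch_eq, trace_fin_two]
  simp
  ring

/-- For a unit vector the operator is an orthogonal projection, hence its own Gram matrix. -/
theorem bloch_posSemidef {u : EuclideanSpace ℝ (Fin 3)} (hu : ‖u‖ = 1) :
    (bloch u).PosSemidef := by
  have hn : (u 0 : ℂ) ^ 2 + (u 1 : ℂ) ^ 2 + (u 2 : ℂ) ^ 2 = 1 := by
    have h := EuclideanSpace.real_norm_sq_eq u
    rw [hu, Fin.sum_univ_three, one_pow] at h
    have h' := congrArg (fun x : ℝ => (x : ℂ)) h
    push_cast at h'
    exact h'.symm
  have h2 : (starRingEnd ℂ) 2 = 2 := Complex.conj_ofNat 2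
  have h : bloch u = (bloch u)ᴴ * bloch u := by
    rw [bloch_eq]
    ext i j
    fin_cases i <;> fin_cases j <;>
      simp [Matrix.mul_apply, Fin.sum_univ_two, h2]
    · linear_combination (-1 / 4 : ℂ) * hn + (1 / 4 : ℂ) * (u 1 : ℂ) ^ 2 * Complex.I_sq
    · ring
    · ring
    · linear_combination (-1 / 4 : ℂ) * hn + (1 / 4 : ℂ) * (u 1 : ℂ) ^ 2 * Complex.I_sq
  rw [h]
  exact posSemidef_conjTranspose_mul_self _

/-- The pure qubit state with unit Bloch vector `u`. -/
noncomputable def blochState (u : EuclideanSpace ℝ (Fin 3)) (hu : ‖u‖ = 1) : DensityMatrix (Fin 2) :=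
  ⟨bloch u, bloch_posSemidef hu, trace_bloch u⟩

theorem bloch_sub_bloch (w₁ w₂ : EuclideanSpace ℝ (Fin 3)) {u : EuclideanSpace ℝ (Fin 3)} {d : ℝ}
    (h : w₂ - w₁ = d • u) :
    bloch w₂ - bloch w₁ = ((d / 2 : ℝ) : ℂ) • (bloch u - bloch (-u)) := by
  have hi : ∀ i, (w₂ i : ℂ) = w₁ i + d * u i := fun i => by
    have := congrArg (fun v : EuclideanSpace ℝ (Fin 3) => v i) h
    simp only [PiLp.sub_apply, PiLp.smul_apply, smul_eq_mul] at this
    exact_mod_cast (by linarith : w₂ i = w₁ i + d * u i)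
  simp only [bloch_eq, hi]
  ext i j
  fin_cases i <;> fin_cases j <;> simp <;> ring

/-- Private channels shrink distances: two output states are close relative to one another. -/
theorem posSemidef_smul_apply_sub {ε : ℝ} {Φ : QuantumChannel (Fin 2)} (hΦ : Φ ∈ LDP (Fin 2) ε)
    {ρ₁ ρ₂ : DensityMatrix (Fin 2)} {w₁ w₂ : EuclideanSpace ℝ (Fin 3)} (h₁ : ρ₁.1 = bloch w₁)
    (h₂ : ρ₂.1 = bloch w₂) (hw : w₂ - w₁ ≠ 0) :
    (((‖w₂ - w₁‖ * (Real.exp ε - 1) : ℝ) : ℂ) • (Φ.apply ρ₁).1 -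
        ((Φ.apply ρ₂).1 - (Φ.apply ρ₁).1)).PosSemidef ∧
      (((‖w₂ - w₁‖ * (Real.exp ε - 1) : ℝ) : ℂ) • (Φ.apply ρ₁).1 +
        ((Φ.apply ρ₂).1 - (Φ.apply ρ₁).1)).PosSemidef := by
  set d := ‖w₂ - w₁‖
  have hd : 0 < d := norm_pos_iff.mpr hw
  have hu : ‖d⁻¹ • (w₂ - w₁)‖ = 1 := by
    rw [norm_smul, norm_inv, Real.norm_of_nonneg hd.le]; exact inv_mul_cancel₀ hd.ne'
  set u := d⁻¹ • (w₂ - w₁)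
  have hdu : w₂ - w₁ = d • u := by simp only [u, smul_smul, mul_inv_cancel₀ hd.ne', one_smul]
  let τ₁ := blochState u hu
  let τ₂ := blochState (-u) (by rw [norm_neg, hu])
  -- By linearity only the direction of `w₂ - w₁` matters. Passing to the extreme states `±u` makes
  -- the bound proportional to `d`, which the direct comparison of `ρ₁` and `ρ₂` would not.
  have hX : (Φ.apply ρ₂).1 - (Φ.apply ρ₁).1 =
      ((d / 2 : ℝ) : ℂ) • ((Φ.apply τ₁).1 - (Φ.apply τ₂).1) := by
    change Φ.toLin ρ₂.1 - Φ.toLin ρ₁.1 = _ • (Φ.toLin (bloch u) - Φ.toLin (bloch (-u)))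
    rw [← map_sub, ← map_sub, ← map_smul, h₁, h₂, bloch_sub_bloch w₁ w₂ hdu]
  have hc : ((d * (Real.exp ε - 1) : ℝ) : ℂ) =
      ((d / 2 : ℝ) : ℂ) * ((2 * (Real.exp ε - 1) : ℝ) : ℂ) := by push_cast; ring
  have hd2 : (0 : ℂ) ≤ ((d / 2 : ℝ) : ℂ) := by exact_mod_cast (by positivity : (0 : ℝ) ≤ d / 2)
  rw [hX, hc, mul_smul, ← smul_sub, ← smul_add]
  refine ⟨(posSemidef_smul_sub_sub hΦ ρ₁ τ₁ τ₂).smul hd2, ?_⟩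
  have h := (posSemidef_smul_sub_sub hΦ ρ₁ τ₂ τ₁).smul hd2
  rwa [← neg_sub (Φ.apply τ₁).1, sub_neg_eq_add] at h

/-! ### The Cramér–Rao bound -/

theorem POVM.law_real {n : Type} [Fintype n] [DecidableEq n] {Ω : Type} [MeasurableSpace Ω]
    (M : POVM n Ω) (ρ : DensityMatrix n) {S : Set Ω} (hS : MeasurableSet S) :
    (M.law ρ).real S = (M.effect S * ρ.1).trace.re := by
  rw [Measure.real, M.law_apply ρ hS, ENNReal.toReal_ofReal]
  exact (Complex.le_def.mp (trace_mul_nonneg (M.posSemidef S) ρ.2.1)).1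

instance {n : Type} [Fintype n] [DecidableEq n] {Ω : Type} [MeasurableSpace Ω]
    (M : POVM n Ω) (ρ : DensityMatrix n) : IsProbabilityMeasure (M.law ρ) :=
  ⟨by rw [M.law_apply ρ MeasurableSet.univ, M.total, Matrix.one_mul, ρ.2.2]; simp⟩

/-- The signed measure `S ↦ Re tr (M(S) A)`. -/
noncomputable def POVM.traceMeasure {n : Type} [Fintype n] [DecidableEq n] {Ω : Type}
    [MeasurableSpace Ω] (M : POVM n Ω) (A : Matrix n n ℂ) : SignedMeasure Ω :=
  M.effect.mapRange (⟨⟨fun B : Matrix n n ℂ => (B * A).trace.re, by simp⟩,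
    fun B C => by simp [Matrix.add_mul]⟩ : Matrix n n ℂ →+ ℝ)
    (by change Continuous fun B : Matrix n n ℂ => (B * A).trace.re; fun_prop)

theorem POVM.traceMeasure_apply {n : Type} [Fintype n] [DecidableEq n] {Ω : Type}
    [MeasurableSpace Ω] (M : POVM n Ω) (A : Matrix n n ℂ) (S : Set Ω) :
    M.traceMeasure A S = (M.effect S * A).trace.re := rfl

/-- The quantum Hammersley–Chapman–Robbins inequality. -/
theorem Estimator.sq_mean_sub_le {n : Type} [Fintype n] [DecidableEq n] (T : Estimator n)
    {τ τ' : DensityMatrix n} {R : Matrix n n ℂ} (hR : τ.1 * R = τ'.1 - τ.1)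
    (h : T.HasMean τ) (h' : T.HasMean τ') {l α : ℝ} (hα : 0 ≤ α) (hl : T.mean τ = l)
    (hv : T.meanSquareError τ l ≤ ENNReal.ofReal α) :
    (T.mean τ' - l) ^ 2 ≤ α * (Rᴴ * τ.1 * R).trace.re := by
  let _ := T.meas
  let f : T.Outcome → ℝ := fun x => T.estimate x - l
  have hf : Measurable f := T.measurable_estimate.sub_const l
  have hP : Integrable T.estimate (T.povm.law τ) := h
  have hP' : Integrable T.estimate (T.povm.law τ') := h'
  have hm : ∫ x, T.estimate x ∂(T.povm.law τ) = l := hl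
  have hv' : ∫⁻ x, ENNReal.ofReal (f x ^ 2) ∂(T.povm.law τ) ≤ ENNReal.ofReal α := by
    refine le_trans (le_of_eq ?_) hv
    change _ = ∫⁻ x, ENNReal.ofReal ((l - T.estimate x) ^ 2) ∂(T.povm.law τ)
    simp only [f, sub_sq_comm]
  have hf2 : Integrable (fun x => f x ^ 2) (T.povm.law τ) := by
    refine ⟨(hf.pow_const 2).aestronglyMeasurable, ?_⟩
    rw [hasFiniteIntegral_iff_ofReal (ae_of_all _ fun x => sq_nonneg _)]
    exact hv'.trans_lt ENNReal.ofReal_lt_top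
  have hvar : ∫ x, f x ^ 2 ∂(T.povm.law τ) ≤ α := by
    rw [integral_eq_lintegral_of_nonneg_ae (ae_of_all _ fun x => sq_nonneg _)
      (hf.pow_const 2).aestronglyMeasurable]
    exact ENNReal.toReal_le_of_le_ofReal hα hv'
  have key := sq_integral_sub_integral_le (P := T.povm.law τ) (P' := T.povm.law τ')
    (T.povm.traceMeasure (Rᴴ * τ.1 * R)) (fun S hS c => by
      rw [T.povm.law_real τ hS, T.povm.law_real τ' hS, T.povm.traceMeasure_apply,
        ← Complex.sub_re, ← trace_sub, ← Matrix.mul_sub, ← hR]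
      exact two_mul_trace_le (T.povm.posSemidef S) τ.2.1 c) hf (hP.sub (integrable_const l))
      (hP'.sub (integrable_const l)) hf2
  rw [T.povm.traceMeasure_apply, T.povm.total, Matrix.one_mul] at key
  have e1 : ∫ x, f x ∂(T.povm.law τ) = 0 := by
    rw [integral_sub hP (integrable_const l), hm]; simp
  have e2 : ∫ x, f x ∂(T.povm.law τ') = T.mean τ' - l := by
    rw [integral_sub hP' (integrable_const l)]; simp [Estimator.mean, Estimator.law]
  rw [e1, e2, sub_zero] at key
  refine key.trans (mul_le_mul_of_nonneg_right hvar ?_)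
  have := (Complex.le_def.mp (τ.2.1.conjTranspose_mul_mul_same R).trace_nonneg).1
  simpa using this

/-- The quantum Hammersley–Chapman–Robbins inequality for independent copies. -/
theorem Estimator.sq_mean_copies_sub_le {n : Type} [Fintype n] [DecidableEq n] {N : ℕ}
    (T : Estimator (Fin N → n)) {σ σ' : DensityMatrix n} {R : Matrix n n ℂ} {k : ℝ}
    (hR : σ.1 * R = σ'.1 - σ.1) (hk : (Rᴴ * σ.1 * R).trace.re ≤ k)
    (h : T.HasMean (σ.copies N)) (h' : T.HasMean (σ'.copies N)) {l α : ℝ} (hα : 0 ≤ α)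
    (hl : T.mean (σ.copies N) = l)
    (hv : T.meanSquareError (σ.copies N) l ≤ ENNReal.ofReal α) :
    (T.mean (σ'.copies N) - l) ^ 2 ≤ α * ((1 + k) ^ N - 1) := by
  have hG : σ.1 * (1 + R) = σ'.1 := by rw [Matrix.mul_add, Matrix.mul_one, hR]; abel
  have hGH : (1 + R)ᴴ * σ.1 = σ'.1 := by
    rw [← σ.2.1.isHermitian.eq, ← conjTranspose_mul, hG, σ'.2.1.isHermitian.eq]
  -- `1 + R` plays the role of a likelihood ratio of `σ'` to `σ`, so its tensor power is that of the
  -- `N` copies.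
  have hN : tensorPower σ.1 N * (tensorPower (1 + R) N - 1) =
      tensorPower σ'.1 N - tensorPower σ.1 N := by
    rw [Matrix.mul_sub, ← tensorPower_mul, hG, Matrix.mul_one]
  refine (T.sq_mean_sub_le (τ := σ.copies N) (τ' := σ'.copies N) hN h h' hα hl hv).trans
    (mul_le_mul_of_nonneg_left ?_ hα)
  have e : ((tensorPower (1 + R) N - 1)ᴴ * tensorPower σ.1 N * (tensorPower (1 + R) N - 1)).trace =
      ((1 + R)ᴴ * σ'.1).trace ^ N - 1 := by
    rw [Matrix.mul_assoc, hN, conjTranspose_sub, conjTranspose_one, Matrix.sub_mul,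
      Matrix.one_mul, Matrix.mul_sub, ← tensorPower_conjTranspose, ← tensorPower_mul,
      ← tensorPower_mul, hGH]
    simp only [trace_sub, trace_tensorPower, σ.2.2, σ'.2.2, one_pow, sub_self, sub_zero]
  have e' : ((1 + R)ᴴ * σ'.1).trace = 1 + (Rᴴ * σ.1 * R).trace := by
    have h1 : Rᴴ * σ.1 = σ'.1 - σ.1 := by
      rw [← hGH, conjTranspose_add, conjTranspose_one, Matrix.add_mul, Matrix.one_mul]; abel
    have h2 : (1 + R)ᴴ * σ'.1 = σ'.1 + (Rᴴ * σ.1 + Rᴴ * σ.1 * R) := by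
      rw [Matrix.mul_assoc, hR, conjTranspose_add, conjTranspose_one, Matrix.add_mul,
        Matrix.one_mul, Matrix.mul_sub]
      abel
    rw [h2, trace_add, trace_add, h1, trace_sub, σ.2.2, σ'.2.2, sub_self, zero_add, ← h1]
  have hpos := Complex.le_def.mp (σ.2.1.conjTranspose_mul_mul_same R).trace_nonneg
  obtain ⟨r, hr⟩ : ∃ r : ℝ, (Rᴴ * σ.1 * R).trace = r :=
    ⟨(Rᴴ * σ.1 * R).trace.re, Complex.ext rfl (by simpa using hpos.2.symm)⟩
  rw [hr, Complex.ofReal_re] at hk hpos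
  change ((tensorPower (1 + R) N - 1)ᴴ * tensorPower σ.1 N *
    (tensorPower (1 + R) N - 1)).trace.re ≤ _
  rw [e, e', hr]
  have : ((1 + (r : ℂ)) ^ N - 1).re = (1 + r) ^ N - 1 := by
    rw [← Complex.ofReal_re ((1 + r) ^ N - 1)]; push_cast; rfl
  rw [this]
  have h0 : 0 ≤ r := hpos.1
  gcongr

/-- The Hammersley–Chapman–Robbins inequality for the output of a private qubit channel. -/
theorem Estimator.sq_mean_apply_sub_le {ε : ℝ} (hε : 0 < ε) {Φ : QuantumChannel (Fin 2)}
    (hΦ : Φ ∈ LDP (Fin 2) ε) {ρ₁ ρ₂ : DensityMatrix (Fin 2)} {w₁ w₂ : EuclideanSpace ℝ (Fin 3)}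
    (h₁ : ρ₁.1 = bloch w₁) (h₂ : ρ₂.1 = bloch w₂) {N : ℕ} (T : Estimator (Fin N → Fin 2))
    (h : T.HasMean ((Φ.apply ρ₁).copies N)) (h' : T.HasMean ((Φ.apply ρ₂).copies N))
    {l α : ℝ} (hα : 0 ≤ α) (hl : T.mean ((Φ.apply ρ₁).copies N) = l)
    (hv : T.meanSquareError ((Φ.apply ρ₁).copies N) l ≤ ENNReal.ofReal α) :
    (T.mean ((Φ.apply ρ₂).copies N) - l) ^ 2 ≤
      α * ((1 + (‖w₂ - w₁‖ * (Real.exp ε - 1)) ^ 2) ^ N - 1) := by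
  by_cases hw : w₂ - w₁ = 0
  · have e : ρ₂ = ρ₁ := Subtype.ext (by rw [h₁, h₂, sub_eq_zero.mp hw])
    rw [e, hl]
    simp [hw]
  · have hδ : 0 < Real.exp ε - 1 := sub_pos.mpr (Real.one_lt_exp_iff.mpr hε)
    obtain ⟨hp, hm⟩ := posSemidef_smul_apply_sub hΦ h₁ h₂ hw
    obtain ⟨R, hR, hk⟩ := exists_mul_eq_of_posSemidef (mul_pos (norm_pos_iff.mpr hw) hδ)
      (Φ.apply ρ₁).2.1 (Φ.apply ρ₁).2.2
      (by rw [trace_sub, (Φ.apply ρ₁).2.2, (Φ.apply ρ₂).2.2, sub_self]) hp hm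
    exact T.sq_mean_copies_sub_le hR hk h h' hα hl hv

/-- The geometric sum `(1 + x)^N - 1 = x ∑ (1 + x)^i` separates a factor tending to `N` from the
squared difference quotient. -/
theorem tendsto_one_add_pow_sub_one_div {E : Type*} [NormedAddCommGroup E] [NormedSpace ℝ E]
    {ω : ℝ → E} {w' : E} {l : ℝ} (hω : HasDerivAt ω w' l) (δ : ℝ) (N : ℕ) :
    Tendsto (fun m => ((1 + (‖ω m - ω l‖ * δ) ^ 2) ^ N - 1) / (m - l) ^ 2) (𝓝[≠] l)
      (𝓝 (N * (‖w'‖ * δ) ^ 2)) := by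
  have hs : Tendsto (fun m => (‖slope ω l m‖ * δ) ^ 2) (𝓝[≠] l) (𝓝 ((‖w'‖ * δ) ^ 2)) :=
    (((hasDerivAt_iff_tendsto_slope.mp hω).norm).mul_const δ).pow 2
  have hx : Tendsto (fun m => ∑ i ∈ Finset.range N, (1 + (‖ω m - ω l‖ * δ) ^ 2) ^ i) (𝓝[≠] l)
      (𝓝 (∑ i ∈ Finset.range N, (1 + (‖ω l - ω l‖ * δ) ^ 2) ^ i)) := by
    have hc : Tendsto ω (𝓝[≠] l) (𝓝 (ω l)) := hω.continuousAt.tendsto.mono_left nhdsWithin_le_nhds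
    exact tendsto_finsetSum _ fun i _ =>
      (((((hc.sub_const (ω l)).norm).mul_const δ).pow 2).const_add 1).pow i
  have hp := hx.mul hs
  simp only [sub_self, norm_zero, zero_mul, ne_eq, OfNat.ofNat_ne_zero, not_false_eq_true,
    zero_pow, add_zero, one_pow, Finset.sum_const, Finset.card_range, nsmul_eq_mul, mul_one] at hp
  refine hp.congr fun m => ?_
  have hg := geom_sum_mul (1 + (‖ω m - ω l‖ * δ) ^ 2) N
  rw [add_sub_cancel_left] at hg
  rw [← hg, slope_def_module, norm_smul, norm_inv, Real.norm_eq_abs, mul_div_assoc]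
  congr 1
  rw [mul_pow, mul_pow, inv_pow, sq_abs, mul_pow]
  field_simp

/-- The Cramér–Rao bound for the output of a private qubit channel. -/
theorem Estimator.IsUnbiasedAt.one_le {ε : ℝ} (hε : 0 < ε) {Φ : QuantumChannel (Fin 2)}
    (hΦ : Φ ∈ LDP (Fin 2) ε) {ρ : ℝ → DensityMatrix (Fin 2)} {ω : ℝ → EuclideanSpace ℝ (Fin 3)}
    {w' : EuclideanSpace ℝ (Fin 3)} {l : ℝ} (hω : HasDerivAt ω w' l)
    (hρ : ∀ᶠ m in 𝓝 l, (ρ m).1 = bloch (ω m)) {N : ℕ} {T : Estimator (Fin N → Fin 2)}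
    (hT : T.IsUnbiasedAt (fun m => (Φ.apply (ρ m)).copies N) l) {α : ℝ} (hα : 0 ≤ α)
    (hv : T.meanSquareError ((Φ.apply (ρ l)).copies N) l ≤ ENNReal.ofReal α) :
    1 ≤ α * (N * (‖w'‖ * (Real.exp ε - 1)) ^ 2) := by
  obtain ⟨hmean, hl, hderiv⟩ := hT
  have t1 := (hasDerivAt_iff_tendsto_slope.mp hderiv).pow 2
  rw [one_pow] at t1
  refine le_of_tendsto_of_tendsto t1
    ((tendsto_one_add_pow_sub_one_div hω (Real.exp ε - 1) N).const_mul α) ?_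
  filter_upwards [nhdsWithin_le_nhds hmean, nhdsWithin_le_nhds hρ, self_mem_nhdsWithin]
    with m hm hρm hml
  have key := T.sq_mean_apply_sub_le hε hΦ hρ.self_of_nhds hρm hmean.self_of_nhds hm hα hl hv
  have hpos : 0 < (m - l) ^ 2 := by
    have : m - l ≠ 0 := sub_ne_zero.mpr hml
    positivity
  rw [slope_def_field, div_pow, ← mul_div_assoc, div_le_div_iff_of_pos_right hpos]
  simpa only [hl] using key

/-- The Cramér–Rao bound gives the constant `1 / ‖w'‖²`; any smaller `c`, such as `C₁`, is then
allowed. -/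
theorem ceil_le_bestSampleComplexity {ρ : ℝ → DensityMatrix (Fin 2)}
    {ω : ℝ → EuclideanSpace ℝ (Fin 3)} {w' : EuclideanSpace ℝ (Fin 3)} {l : ℝ}
    (hω : HasDerivAt ω w' l) (hρ : ∀ᶠ m in 𝓝 l, (ρ m).1 = bloch (ω m)) {α ε c : ℝ} (hα : 0 < α)
    (hε : 0 < ε) (hw' : w' ≠ 0) (hc : c ≤ 1 / ‖w'‖ ^ 2) :
    (⌈c / (α * (Real.exp ε - 1) ^ 2)⌉₊ : ℕ∞) ≤ bestSampleComplexity ρ l α ε := by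
  refine le_iInf₂ fun Φ hΦ => le_iInf₂ fun N hN => ?_
  obtain ⟨T, hT, hv⟩ := hN
  have h := hT.one_le hε hΦ hω hρ hα.le hv
  have hδ : 0 < Real.exp ε - 1 := sub_pos.mpr (Real.one_lt_exp_iff.mpr hε)
  have hn : 0 < ‖w'‖ := norm_pos_iff.mpr hw'
  have hle : c / (α * (Real.exp ε - 1) ^ 2) ≤ N := by
    rw [div_le_iff₀ (by positivity)]
    refine hc.trans ?_
    rw [div_le_iff₀ (by positivity)]
    calc (1 : ℝ) ≤ _ := h
      _ = _ := by ring
  exact_mod_cast Nat.ceil_le.mpr hle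

/-! ### The depolarizing channel -/

/-- The depolarizing map `X ↦ p X + (1 - p) tr(X) I / 2`. -/
noncomputable def depolarizingMap (p : ℝ) :
    Matrix (Fin 2) (Fin 2) ℂ →ₗ[ℂ] Matrix (Fin 2) (Fin 2) ℂ :=
  (p : ℂ) • LinearMap.id +
    (((1 - p) / 2 : ℝ) : ℂ) • (Matrix.traceLinearMap (Fin 2) ℂ ℂ).smulRight 1

theorem depolarizingMap_apply (p : ℝ) (X : Matrix (Fin 2) (Fin 2) ℂ) :
    depolarizingMap p X =
      (p : ℂ) • X + (((1 - p) / 2 : ℝ) : ℂ) • X.trace • (1 : Matrix (Fin 2) (Fin 2) ℂ) := rfl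

/-- Replacing each block by its trace times the identity is completely positive. -/
theorem posSemidef_comp_trace {n : Type} [Fintype n] [DecidableEq n] {k : ℕ}
    {X : Matrix (Fin k) (Fin k) (Matrix n n ℂ)} (hX : (Matrix.comp (Fin k) (Fin k) n n ℂ X).PosSemidef) :
    (Matrix.comp (Fin k) (Fin k) n n ℂ
      (X.map fun A => A.trace • (1 : Matrix n n ℂ))).PosSemidef := by
  -- The partial trace is a sum of principal submatrices; the map is this partial trace followed by
  -- a Kronecker product with the identity.
  have h1 : (Matrix.of fun i j => (X i j).trace).PosSemidef := by
    have e : (Matrix.of fun i j => (X i j).trace) =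
        ∑ c : n, (Matrix.comp (Fin k) (Fin k) n n ℂ X).submatrix (fun i => (i, c))
          (fun i => (i, c)) := by
      ext i j
      simp [Matrix.trace, Matrix.sum_apply]
    rw [e]
    exact posSemidef_sum _ fun c _ => hX.submatrix _
  have h2 := h1.kronecker (PosSemidef.one (n := n) (R := ℂ))
  have e : Matrix.comp (Fin k) (Fin k) n n ℂ (X.map fun A => A.trace • (1 : Matrix n n ℂ)) =
      Matrix.kroneckerMap (fun x y => x * y) (Matrix.of fun i j => (X i j).trace) 1 := by
    ext ⟨i, a⟩ ⟨j, b⟩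
    simp [Matrix.kroneckerMap_apply]
  rw [e]
  exact h2

/-- The depolarizing qubit channel. -/
noncomputable def depolarizing (p : ℝ) (h0 : 0 ≤ p) (h1 : p ≤ 1) : QuantumChannel (Fin 2) where
  toLin := depolarizingMap p
  completelyPositive k X hX := by
    have h := (hX.smul (a := (p : ℂ)) (by exact_mod_cast h0)).add
      ((posSemidef_comp_trace hX).smul (a := (((1 - p) / 2 : ℝ) : ℂ))
        (by exact_mod_cast (by linarith : 0 ≤ (1 - p) / 2)))
    exact h
  tracePreserving X := by
    rw [depolarizingMap_apply, trace_add, trace_smul, trace_smul, trace_smul, trace_one]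
    simp only [smul_eq_mul, Fintype.card_fin]
    push_cast
    ring

/-- A qubit state is at most the identity. -/
theorem one_sub_posSemidef (ρ : DensityMatrix (Fin 2)) : (1 - ρ.1).PosSemidef := by
  have h := ρ.2.1.transpose.mul_mul_conjTranspose_same (!![0, 1; -1, 0] : Matrix (Fin 2) (Fin 2) ℂ)
  have ht := ρ.2.2
  rw [trace_fin_two] at ht
  -- In dimension two `tr(ρ) I - ρ` is the adjugate, which is congruent to the transpose of `ρ`.
  have e : 1 - ρ.1 = !![0, 1; -1, 0] * ρ.1ᵀ * (!![0, 1; -1, 0] : Matrix (Fin 2) (Fin 2) ℂ)ᴴ := by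
    ext i j
    fin_cases i <;> fin_cases j <;> simp [Matrix.mul_apply, Fin.sum_univ_two, Matrix.vecMul,
      dotProduct]
    · linear_combination -ht
    · linear_combination -ht
  rw [e]
  exact h

/-- Since `0 ≤ tr (M τ) ≤ tr M` for every state `τ`, the output probabilities lie between `(1 - p) /
2` and `(1 + p) / 2` times `tr M`. -/
theorem depolarizing_mem_LDP {ε : ℝ} (p : ℝ) (h0 : 0 ≤ p) (h1 : p ≤ 1)
    (hp : 1 + p ≤ Real.exp ε * (1 - p)) : depolarizing p h0 h1 ∈ LDP (Fin 2) ε := by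
  intro M hM _ ρ σ
  have key : ∀ τ : DensityMatrix (Fin 2), (M * ((depolarizing p h0 h1).apply τ).1).trace.re =
      p * (M * τ.1).trace.re + (1 - p) / 2 * M.trace.re := by
    intro τ
    change (M * depolarizingMap p τ.1).trace.re = _
    rw [depolarizingMap_apply, τ.2.2, one_smul, Matrix.mul_add, Matrix.mul_smul, Matrix.mul_smul,
      Matrix.mul_one, trace_add, trace_smul, trace_smul, smul_eq_mul, smul_eq_mul, Complex.add_re,
      Complex.re_ofReal_mul, Complex.re_ofReal_mul]
  have hσ : 0 ≤ (M * σ.1).trace.re := (Complex.le_def.mp (trace_mul_nonneg hM σ.2.1)).1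
  have hρ : (M * ρ.1).trace.re ≤ M.trace.re := by
    have h := (Complex.le_def.mp (trace_mul_nonneg hM (one_sub_posSemidef ρ))).1
    rw [Matrix.mul_sub, Matrix.mul_one, trace_sub, Complex.sub_re, Complex.zero_re] at h
    linarith
  have hM0 : 0 ≤ M.trace.re := (Complex.le_def.mp hM.trace_nonneg).1
  rw [key, key]
  have hE := Real.exp_pos ε
  nlinarith [mul_le_mul_of_nonneg_left hρ h0, mul_nonneg hE.le (mul_nonneg h0 hσ),
    mul_le_mul_of_nonneg_right hp hM0]

theorem depolarizingMap_bloch (p : ℝ) (w : EuclideanSpace ℝ (Fin 3)) :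
    depolarizingMap p (bloch w) = bloch (p • w) := by
  rw [depolarizingMap_apply, trace_bloch, bloch_eq, bloch_eq]
  ext i j
  fin_cases i <;> fin_cases j <;> simp <;> ring

theorem trace_bloch_mul_bloch (u w : EuclideanSpace ℝ (Fin 3)) :
    (bloch u * bloch w).trace = (((1 + inner ℝ u w) / 2 : ℝ) : ℂ) := by
  have hi : inner ℝ u w = u 0 * w 0 + u 1 * w 1 + u 2 * w 2 := by
    simp [PiLp.inner_apply, Fin.sum_univ_three, mul_comm]
  rw [hi, bloch_eq, bloch_eq, trace_fin_two]
  simp [Matrix.mul_apply, Fin.sum_univ_two]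
  linear_combination (-1 / 2 : ℂ) * (u 1 : ℂ) * (w 1 : ℂ) * Complex.I_sq

/-! ### Product measurements -/

/-- The entries of the tensor product of `N` matrices. -/
def tensorProd {n : Type} {N : ℕ} (A : Fin N → Matrix n n ℂ) : Matrix (Fin N → n) (Fin N → n) ℂ :=
  Matrix.of fun i j => ∏ k, A k (i k) (j k)

theorem tensorProd_mul {n : Type} [Fintype n] {N : ℕ} (A B : Fin N → Matrix n n ℂ) :
    tensorProd A * tensorProd B = tensorProd fun k => A k * B k := by
  classical
  ext i j
  simp [tensorProd, Matrix.mul_apply, Finset.prod_univ_sum, Finset.prod_mul_distrib]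

theorem trace_tensorProd {n : Type} [Fintype n] {N : ℕ} (A : Fin N → Matrix n n ℂ) :
    (tensorProd A).trace = ∏ k, (A k).trace := by
  classical
  simp [tensorProd, Matrix.trace, Finset.prod_univ_sum]

theorem tensorProd_posSemidef {n : Type} [Fintype n] {N : ℕ} {A : Fin N → Matrix n n ℂ}
    (hA : ∀ k, (A k).PosSemidef) : (tensorProd A).PosSemidef := by
  choose B hB using fun k => exists_gram (hA k)
  have h : tensorProd A = (tensorProd B)ᴴ * tensorProd B := by
    have e : (tensorProd B)ᴴ = tensorProd fun k => (B k)ᴴ := by ext i j; simp [tensorProd]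
    rw [e, tensorProd_mul]
    exact congrArg tensorProd (funext hB)
  rw [h]
  exact posSemidef_conjTranspose_mul_self _

/-- Entrywise this is the expansion of a product of sums; off the diagonal one of the factors is
zero. -/
theorem sum_tensorProd {n κ : Type} [Fintype n] [DecidableEq n] [Fintype κ] {E : κ → Matrix n n ℂ}
    (hE : ∑ a, E a = 1) (N : ℕ) : ∑ s : Fin N → κ, tensorProd (fun k => E (s k)) = 1 := by
  classical
  ext i j
  have h : ∀ k, ∑ a, E a (i k) (j k) = (1 : Matrix n n ℂ) (i k) (j k) := fun k => by
    rw [← hE, Matrix.sum_apply]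
  rw [Matrix.sum_apply]
  have e := (Finset.prod_univ_sum (fun _ : Fin N => (Finset.univ : Finset κ))
    (fun k a => E a (i k) (j k))).symm
  rw [Fintype.piFinset_univ] at e
  refine e.trans ?_
  simp only [h, Matrix.one_apply, funext_iff]
  by_cases hij : ∀ k, i k = j k
  · simp [hij]
  · rw [if_neg hij]
    push Not at hij
    obtain ⟨k, hk⟩ := hij
    exact Finset.prod_eq_zero (Finset.mem_univ k) (if_neg hk)

/-- Measuring each of `N` systems with the POVM given by the effects `E a`. -/
noncomputable def productPOVM {n κ : Type} [Fintype n] [DecidableEq n] [Fintype κ]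
    [MeasurableSpace κ] {E : κ → Matrix n n ℂ} (hpos : ∀ a, (E a).PosSemidef)
    (hsum : ∑ a, E a = 1) (N : ℕ) : POVM (Fin N → n) (Fin N → κ) where
  effect := ∑ s : Fin N → κ, VectorMeasure.dirac s (tensorProd fun k => E (s k))
  posSemidef S := by
    classical
    rw [FunLike.coe_sum, Finset.sum_apply]
    refine posSemidef_sum _ fun s _ => ?_
    -- A vector measure takes the value zero on nonmeasurable sets.
    by_cases h : MeasurableSet S ∧ s ∈ S
    · rw [VectorMeasure.dirac_apply_of_mem h.1 h.2]
      exact tensorProd_posSemidef fun k => hpos (s k)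
    · have : VectorMeasure.dirac s (tensorProd fun k => E (s k)) S = 0 := by
        by_cases hS : MeasurableSet S
        · exact VectorMeasure.dirac_apply_of_notMem fun hs => h ⟨hS, hs⟩
        · exact VectorMeasure.not_measurable _ hS
      rw [this]
      exact PosSemidef.zero
  total := by
    rw [FunLike.coe_sum, Finset.sum_apply, ← sum_tensorProd hsum N]
    exact Finset.sum_congr rfl fun s _ =>
      VectorMeasure.dirac_apply_of_mem MeasurableSet.univ (Set.mem_univ s)

theorem productPOVM_law_real_singleton {n κ : Type} [Fintype n] [DecidableEq n] [Fintype κ]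
    [MeasurableSpace κ] [MeasurableSingletonClass κ] {E : κ → Matrix n n ℂ}
    (hpos : ∀ a, (E a).PosSemidef) (hsum : ∑ a, E a = 1) (N : ℕ) (ρ : DensityMatrix n) {q : κ → ℝ}
    (hq : ∀ a, (E a * ρ.1).trace = q a) (s : Fin N → κ) :
    ((productPOVM hpos hsum N).law (ρ.copies N)).real {s} = ∏ k, q (s k) := by
  classical
  rw [POVM.law_real _ _ (measurableSet_singleton s)]
  have h : (productPOVM hpos hsum N).effect {s} = tensorProd fun k => E (s k) := by
    simp only [productPOVM]
    rw [FunLike.coe_sum, Finset.sum_apply, Finset.sum_eq_single s]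
    · exact VectorMeasure.dirac_apply_of_mem (measurableSet_singleton s) rfl
    · intro t _ ht
      exact VectorMeasure.dirac_apply_of_notMem (by simpa using ht)
    · simp
  have h2 : (ρ.copies N).1 = tensorProd fun _ => ρ.1 := rfl
  rw [h, h2, tensorProd_mul, trace_tensorProd]
  simp only [hq]
  rw [← Complex.ofReal_prod, Complex.ofReal_re]

/-- The `j`-th marginal of a product law: `g` is absorbed into the `j`-th factor and every other
factor sums to one. -/
theorem sum_prod_mul_apply {κ : Type} [Fintype κ] {N : ℕ} {q : κ → ℝ} (hq : ∑ a, q a = 1)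
    (g : κ → ℝ) (j : Fin N) : ∑ s : Fin N → κ, (∏ k, q (s k)) * g (s j) = ∑ a, q a * g a := by
  classical
  have e := (Finset.prod_univ_sum (fun _ : Fin N => (Finset.univ : Finset κ))
    (fun k a => q a * if k = j then g a else 1)).symm
  rw [Fintype.piFinset_univ] at e
  simp only [Finset.prod_mul_distrib, Finset.prod_ite_eq', Finset.mem_univ, if_true] at e
  rw [e, Finset.prod_eq_single j]
  · simp
  · intro k _ hk
    simp [hk, hq]
  · simp

theorem sum_prod_mul_sum {κ : Type} [Fintype κ] {N : ℕ} {q : κ → ℝ} (hq : ∑ a, q a = 1)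
    (g : κ → ℝ) :
    ∑ s : Fin N → κ, (∏ k, q (s k)) * ∑ j, g (s j) = N * ∑ a, q a * g a := by
  simp only [Finset.mul_sum]
  rw [Finset.sum_comm]
  simp only [sum_prod_mul_apply hq, Finset.sum_const, Finset.card_univ, Fintype.card_fin,
    nsmul_eq_mul, Finset.mul_sum]

/-- The variance of a sum of independent centered variables. -/
theorem sum_prod_mul_sq_sum {κ : Type} [Fintype κ] {N : ℕ} {q : κ → ℝ} (hq : ∑ a, q a = 1)
    {g : κ → ℝ} (hg : ∑ a, q a * g a = 0) :
    ∑ s : Fin N → κ, (∏ k, q (s k)) * (∑ j, g (s j)) ^ 2 = N * ∑ a, q a * g a ^ 2 := by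
  classical
  have h : ∀ i j : Fin N, ∑ s : Fin N → κ, (∏ k, q (s k)) * (g (s i) * g (s j)) =
      if i = j then ∑ a, q a * g a ^ 2 else 0 := by
    intro i j
    split_ifs with hij
    · subst hij
      simpa only [← pow_two] using sum_prod_mul_apply hq (fun a => g a ^ 2) i
    · have e := (Finset.prod_univ_sum (fun _ : Fin N => (Finset.univ : Finset κ))
        (fun k a => q a * ((if k = i then g a else 1) * if k = j then g a else 1))).symm
      rw [Fintype.piFinset_univ] at e
      simp only [Finset.prod_mul_distrib, Finset.prod_ite_eq', Finset.mem_univ, if_true] at e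
      rw [e]
      exact Finset.prod_eq_zero (Finset.mem_univ i) (by simp [hij, hg])
  calc _ = ∑ s : Fin N → κ, ∑ i, ∑ j, (∏ k, q (s k)) * (g (s i) * g (s j)) :=
        Finset.sum_congr rfl fun s _ => by
          rw [pow_two, Finset.sum_mul_sum, Finset.mul_sum]
          simp only [Finset.mul_sum]
    _ = ∑ i : Fin N, ∑ j : Fin N, ∑ s : Fin N → κ, (∏ k, q (s k)) * (g (s i) * g (s j)) := by
        rw [Finset.sum_comm]
        exact Finset.sum_congr rfl fun i _ => Finset.sum_comm
    _ = _ := by simp [h, Finset.mul_sum]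

/-! ### The averaging estimator -/

theorem bloch_add_bloch_neg (u : EuclideanSpace ℝ (Fin 3)) : bloch u + bloch (-u) = 1 := by
  rw [bloch_eq, bloch_eq]
  ext i j
  fin_cases i <;> fin_cases j <;> simp <;> ring

/-- The effects of the spin measurement in the direction `u`. -/
noncomputable def spinEffect (u : EuclideanSpace ℝ (Fin 3)) : Fin 2 → Matrix (Fin 2) (Fin 2) ℂ :=
  ![bloch u, bloch (-u)]

theorem spinEffect_posSemidef {u : EuclideanSpace ℝ (Fin 3)} (hu : ‖u‖ = 1) (a : Fin 2) :
    (spinEffect u a).PosSemidef := by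
  fin_cases a
  · exact bloch_posSemidef hu
  · exact bloch_posSemidef (by rw [norm_neg, hu])

theorem sum_spinEffect (u : EuclideanSpace ℝ (Fin 3)) : ∑ a, spinEffect u a = 1 := by
  rw [Fin.sum_univ_two]
  exact bloch_add_bloch_neg u

/-- The distribution of the spin of a qubit, as a function of its mean. -/
noncomputable def spinWeight (x : ℝ) : Fin 2 → ℝ := ![(1 + x) / 2, (1 - x) / 2]

theorem trace_spinEffect_mul_bloch (u w : EuclideanSpace ℝ (Fin 3)) (a : Fin 2) :
    (spinEffect u a * bloch w).trace = spinWeight (inner ℝ u w) a := by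
  fin_cases a
  · exact trace_bloch_mul_bloch u w
  · refine (trace_bloch_mul_bloch (-u) w).trans ?_
    rw [inner_neg_left]
    rfl

theorem sum_spinWeight (x : ℝ) : ∑ a, spinWeight x a = 1 := by
  simp [spinWeight, Fin.sum_univ_two]; ring

/-- The average of the spins in the direction `u`, rescaled to an estimator of the parameter. -/
noncomputable def averageEstimator {u : EuclideanSpace ℝ (Fin 3)} (hu : ‖u‖ = 1) (N : ℕ)
    (l c x : ℝ) : Estimator (Fin N → Fin 2) where
  Outcome := Fin N → Fin 2
  povm := productPOVM (spinEffect_posSemidef hu) (sum_spinEffect u) N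
  estimate s := l + c / N * ∑ k, ((![1, -1] : Fin 2 → ℝ) (s k) - x)
  measurable_estimate := measurable_of_finite _

theorem averageEstimator_hasMean {u : EuclideanSpace ℝ (Fin 3)} (hu : ‖u‖ = 1) (N : ℕ)
    (l c x : ℝ) (ρ : DensityMatrix (Fin N → Fin 2)) : (averageEstimator hu N l c x).HasMean ρ :=
  Integrable.of_finite (μ := (productPOVM (spinEffect_posSemidef hu) (sum_spinEffect u) N).law ρ)

theorem averageEstimator_integral {u : EuclideanSpace ℝ (Fin 3)} (hu : ‖u‖ = 1) (N : ℕ)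
    {ρ : DensityMatrix (Fin 2)} {w : EuclideanSpace ℝ (Fin 3)} (hρ : ρ.1 = bloch w)
    (f : (Fin N → Fin 2) → ℝ) :
    ∫ s, f s ∂((productPOVM (spinEffect_posSemidef hu) (sum_spinEffect u) N).law (ρ.copies N)) =
      ∑ s, (∏ k, spinWeight (inner ℝ u w) (s k)) * f s := by
  rw [integral_fintype Integrable.of_finite]
  refine Finset.sum_congr rfl fun s _ => ?_
  rw [productPOVM_law_real_singleton _ _ _ _ (fun a => by
    rw [hρ]; exact trace_spinEffect_mul_bloch u w a), smul_eq_mul]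

theorem sum_prod_spinWeight (N : ℕ) (y : ℝ) :
    ∑ s : Fin N → Fin 2, ∏ k, spinWeight y (s k) = 1 := by
  classical
  have e := (Finset.prod_univ_sum (fun _ : Fin N => (Finset.univ : Finset (Fin 2)))
    (fun _ a => spinWeight y a)).symm
  rw [Fintype.piFinset_univ] at e
  rw [e]
  simp only [sum_spinWeight, Finset.prod_const_one]

theorem averageEstimator_mean {u : EuclideanSpace ℝ (Fin 3)} (hu : ‖u‖ = 1) {N : ℕ} (hN : N ≠ 0)
    (l c x : ℝ) {ρ : DensityMatrix (Fin 2)} {w : EuclideanSpace ℝ (Fin 3)}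
    (hρ : ρ.1 = bloch w) :
    (averageEstimator hu N l c x).mean (ρ.copies N) = l + c * (inner ℝ u w - x) := by
  refine (averageEstimator_integral hu N hρ _).trans ?_
  simp only [averageEstimator, mul_add, mul_left_comm _ (c / (N : ℝ)), Finset.sum_add_distrib,
    ← Finset.mul_sum, ← Finset.sum_mul, sum_prod_spinWeight, one_mul]
  have hs := sum_prod_mul_sum (N := N) (sum_spinWeight (inner ℝ u w))
    (fun a => (![1, -1] : Fin 2 → ℝ) a - x)
  rw [hs]
  have hN' : (N : ℝ) ≠ 0 := by exact_mod_cast hN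
  simp only [Fin.sum_univ_two, spinWeight, cons_val_zero, cons_val_one]
  field_simp
  ring

/-- A single spin of mean `x` has variance `1 - x² ≤ 1`, and the variances of independent copies
add. -/
theorem averageEstimator_meanSquareError {u : EuclideanSpace ℝ (Fin 3)} (hu : ‖u‖ = 1) {N : ℕ}
    (hN : N ≠ 0) (l c : ℝ) {ρ : DensityMatrix (Fin 2)} {w : EuclideanSpace ℝ (Fin 3)}
    (hρ : ρ.1 = bloch w) :
    (averageEstimator hu N l c (inner ℝ u w)).meanSquareError (ρ.copies N) l ≤
      ENNReal.ofReal (c ^ 2 / N) := by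
  set x : ℝ := inner ℝ u w
  let M := productPOVM (spinEffect_posSemidef hu) (sum_spinEffect u) N
  change ∫⁻ s, ENNReal.ofReal ((l - (averageEstimator hu N l c x).estimate s) ^ 2)
    ∂(M.law (ρ.copies N)) ≤ _
  rw [← ofReal_integral_eq_lintegral_ofReal Integrable.of_finite (ae_of_all _ fun s => sq_nonneg _)]
  refine ENNReal.ofReal_le_ofReal ?_
  rw [averageEstimator_integral hu N hρ]
  have hsq : ∀ s : Fin N → Fin 2, (l - (averageEstimator hu N l c x).estimate s) ^ 2 =
      (c / N) ^ 2 * (∑ k, ((![1, -1] : Fin 2 → ℝ) (s k) - x)) ^ 2 := fun s => by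
    simp only [averageEstimator]; ring
  have hs := sum_prod_mul_sq_sum (N := N) (sum_spinWeight x)
    (g := fun a => (![1, -1] : Fin 2 → ℝ) a - x)
    (by simp only [Fin.sum_univ_two, spinWeight, cons_val_zero, cons_val_one]; ring)
  simp only [hsq, mul_left_comm _ ((c / (N : ℝ)) ^ 2), ← Finset.mul_sum]
  rw [hs]
  have hN' : (0 : ℝ) < N := by exact_mod_cast Nat.pos_of_ne_zero hN
  have e : (c / N) ^ 2 * (N * ∑ a, spinWeight x a * ((![1, -1] : Fin 2 → ℝ) a - x) ^ 2) =
      c ^ 2 / N * (1 - x ^ 2) := by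
    simp only [Fin.sum_univ_two, spinWeight, cons_val_zero, cons_val_one]
    field_simp
    ring
  rw [e]
  exact mul_le_of_le_one_right (by positivity) (by nlinarith [sq_nonneg x])

theorem bestSampleComplexity_le {ρ : ℝ → DensityMatrix (Fin 2)}
    {ω : ℝ → EuclideanSpace ℝ (Fin 3)} {w' : EuclideanSpace ℝ (Fin 3)} {l : ℝ}
    (hω : HasDerivAt ω w' l) (hρ : ∀ᶠ m in 𝓝 l, (ρ m).1 = bloch (ω m)) {α ε : ℝ} (hα : 0 < α)
    (hε : 0 < ε) (hw' : w' ≠ 0) :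
    bestSampleComplexity ρ l α ε ≤
      (⌈C₂ w' * (Real.exp ε + 1) ^ 2 / (α * (Real.exp ε - 1) ^ 2)⌉₊ : ℕ∞) := by
  set N := ⌈C₂ w' * (Real.exp ε + 1) ^ 2 / (α * (Real.exp ε - 1) ^ 2)⌉₊
  have hδ : 0 < Real.exp ε - 1 := sub_pos.mpr (Real.one_lt_exp_iff.mpr hε)
  have hE : 0 < Real.exp ε + 1 := by positivity
  have hn : 0 < ‖w'‖ := norm_pos_iff.mpr hw'
  have hx : 0 < C₂ w' * (Real.exp ε + 1) ^ 2 / (α * (Real.exp ε - 1) ^ 2) := by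
    unfold C₂; positivity
  have hN : N ≠ 0 := (Nat.ceil_pos.mpr hx).ne'
  have hN' : (0 : ℝ) < N := by exact_mod_cast Nat.pos_of_ne_zero hN
  -- The weakest depolarization that the privacy condition `1 + p ≤ E (1 - p)` permits: equality
  -- holds.
  set p := (Real.exp ε - 1) / (Real.exp ε + 1) with hp
  have hp0 : 0 < p := by positivity
  have hp1 : p ≤ 1 := by rw [hp, div_le_one hE]; linarith
  have hpE : 1 + p ≤ Real.exp ε * (1 - p) := by
    refine le_of_eq ?_
    rw [hp]; field_simp; ring
  let Φ := depolarizing p hp0.le hp1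
  have hu : ‖‖w'‖⁻¹ • w'‖ = 1 := by
    rw [norm_smul, norm_inv, norm_norm, inv_mul_cancel₀ hn.ne']
  set u := ‖w'‖⁻¹ • w'
  have hΦ : ∀ m, (ρ m).1 = bloch (ω m) → (Φ.apply (ρ m)).1 = bloch (p • ω m) := fun m hm => by
    change depolarizingMap p (ρ m).1 = _
    rw [hm, depolarizingMap_bloch]
  -- The mean spin along `u` has derivative `p ‖w'‖` at `l`; this scaling makes the derivative of
  -- the estimate one.
  let c := (p * ‖w'‖)⁻¹
  let T := averageEstimator hu N l c (inner ℝ u (p • ω l))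
  refine (iInf₂_le Φ (depolarizing_mem_LDP p hp0.le hp1 hpE)).trans (iInf₂_le N ⟨T, ⟨?_, ?_, ?_⟩, ?_⟩)
  · exact Eventually.of_forall fun m => averageEstimator_hasMean hu N _ _ _ _
  · rw [averageEstimator_mean hu hN _ _ _ (hΦ l hρ.self_of_nhds)]
    simp
  · have hmean : (fun m => T.mean ((Φ.apply (ρ m)).copies N)) =ᶠ[𝓝 l]
        fun m => l + c * (inner ℝ u (p • ω m) - inner ℝ u (p • ω l)) := by
      filter_upwards [hρ] with m hm
      exact averageEstimator_mean hu hN _ _ _ (hΦ m hm)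
    refine HasDerivAt.congr_of_eventuallyEq ?_ hmean
    have hd : HasDerivAt (fun m => l + c * (inner ℝ u (p • ω m) - inner ℝ u (p • ω l)))
        (c * (inner ℝ u (p • w') + inner ℝ 0 (p • ω l))) l :=
      ((((hasDerivAt_const l u).inner ℝ (hω.const_smul p)).sub_const
        (inner ℝ u (p • ω l))).const_mul c).const_add l
    have hval : c * (inner ℝ u (p • w') + inner ℝ 0 (p • ω l)) = 1 := by
      simp only [inner_zero_left, inner_smul_right, u, real_inner_smul_left,
        real_inner_self_eq_norm_sq, c]
      field_simp
      exact add_zero _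
    rwa [hval] at hd
  · refine (averageEstimator_meanSquareError hu hN l c (hΦ l hρ.self_of_nhds)).trans
      (ENNReal.ofReal_le_ofReal ?_)
    have hle : C₂ w' * (Real.exp ε + 1) ^ 2 / (α * (Real.exp ε - 1) ^ 2) ≤ N := Nat.le_ceil _
    rw [div_le_iff₀ (by positivity)] at hle
    rw [div_le_iff₀ hN']
    simp only [c, hp]
    rw [inv_pow, mul_pow, div_pow, inv_le_iff_one_le_mul₀ (by positivity)]
    unfold C₂ at hle
    rw [one_div, inv_mul_le_iff₀ (by positivity)] at hle
    rw [← div_le_div_iff_of_pos_right (by positivity : 0 < (Real.exp ε + 1) ^ 2),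
      div_self (by positivity)] at hle
    refine hle.trans (le_of_eq ?_)
    field_simp

end QuantumEstimation

/-! ### The theorem and its small-`ε` asymptotics -/

open QuantumEstimation in
theorem theorem1
    (Λ : Set ℝ) (hΛ : IsOpen Λ) (ρ : ℝ → DensityMatrix (Fin 2))
    (ω : ℝ → EuclideanSpace ℝ (Fin 3)) (hω : ContDiffOn ℝ 1 ω Λ)
    (hρ : ∀ m ∈ Λ, (ρ m).1 = bloch (ω m))
    (l : ℝ) (hl : l ∈ Λ) (hne : inner ℝ (deriv ω l) (ω l) ≠ 0) :
    (∀ α > 0, ∀ ε > 0,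
      ENNReal.ofReal (C₁ (ω l) (deriv ω l) / (α * (Real.exp ε - 1) ^ 2)) ≤
          (bestSampleComplexity ρ l α ε : ℝ≥0∞) ∧
        bestSampleComplexity ρ l α ε ≤
          (⌈C₂ (deriv ω l) * (Real.exp ε + 1) ^ 2 / (α * (Real.exp ε - 1) ^ 2)⌉₊ : ℕ∞)) ∧
    ∃ c₁ > 0, ∃ c₂ > 0, ∀ α > 0, ∃ ε₀ > 0, ∀ ε ∈ Set.Ioo (0 : ℝ) ε₀,
      ENNReal.ofReal (c₁ * (α⁻¹ * (ε ^ 2)⁻¹)) ≤ (bestSampleComplexity ρ l α ε : ℝ≥0∞) ∧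
        (bestSampleComplexity ρ l α ε : ℝ≥0∞) ≤ ENNReal.ofReal (c₂ * (α⁻¹ * (ε ^ 2)⁻¹)) := by
  have hd : HasDerivAt ω (deriv ω l) l :=
    ((hω.differentiableOn one_ne_zero).differentiableAt (hΛ.mem_nhds hl)).hasDerivAt
  have hρ' : ∀ᶠ m in 𝓝 l, (ρ m).1 = bloch (ω m) := by
    filter_upwards [hΛ.mem_nhds hl] with m hm using hρ m hm
  have hw' : deriv ω l ≠ 0 := fun h => hne (by rw [h, inner_zero_left])
  set w' := deriv ω l
  have hn : 0 < ‖w'‖ := norm_pos_iff.mpr hw'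
  have hi : 0 < |inner ℝ w' (ω l)| := abs_pos.mpr hne
  have hC1 : C₁ (ω l) w' ≤ 1 / ‖w'‖ ^ 2 := by
    refine mul_le_of_le_one_right (by positivity) (inv_le_one_of_one_le₀ ?_)
    have : 0 ≤ 1 / 4 * (‖w'‖ ^ 2 / |inner ℝ w' (ω l)| ^ 2) := by positivity
    linarith
  have hC1pos : 0 < C₁ (ω l) w' := by unfold C₁; positivity
  have hC2pos : 0 < C₂ w' := by unfold C₂; positivity
  have main : ∀ α > 0, ∀ ε > 0,
      ENNReal.ofReal (C₁ (ω l) w' / (α * (Real.exp ε - 1) ^ 2)) ≤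
          (bestSampleComplexity ρ l α ε : ℝ≥0∞) ∧
        bestSampleComplexity ρ l α ε ≤
          (⌈C₂ w' * (Real.exp ε + 1) ^ 2 / (α * (Real.exp ε - 1) ^ 2)⌉₊ : ℕ∞) := by
    intro α hα ε hε
    refine ⟨?_, bestSampleComplexity_le hd hρ' hα hε hw'⟩
    have h := ENat.toENNReal_le.mpr (ceil_le_bestSampleComplexity hd hρ' hα hε hw' hC1)
    refine le_trans ?_ h
    rw [ENat.toENNReal_coe, ← ENNReal.ofReal_natCast]
    exact ENNReal.ofReal_le_ofReal (Nat.le_ceil _)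
  -- For `ε < 1`, `ε ≤ E - 1 ≤ 2 ε` and `E + 1 ≤ 4`. This gives the factor `1 / 4` below and `16`
  -- above. The ceiling costs at most one more, which `ε² ≤ C₂ / α` absorbs as one further multiple
  -- of `C₂`, hence `17`; this is why `ε₀` depends on `α`.
  refine ⟨main, C₁ (ω l) w' / 4, by positivity, 17 * C₂ w', by positivity, fun α hα =>
    ⟨min 1 (√(C₂ w' / α)), lt_min one_pos (Real.sqrt_pos.mpr (by positivity)), fun ε hε => ?_⟩⟩
  obtain ⟨hε0, hε1⟩ := hε
  obtain ⟨hε1, hε2⟩ := lt_min_iff.mp hε1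
  have hlow : ε ≤ Real.exp ε - 1 := by linarith [Real.add_one_le_exp ε]
  have hupp : Real.exp ε - 1 ≤ 2 * ε := by
    have := Real.abs_exp_sub_one_le (x := ε) (by rw [abs_of_pos hε0]; exact hε1.le)
    rw [abs_of_pos hε0] at this
    exact (le_abs_self _).trans this
  have hε2' : ε ^ 2 ≤ C₂ w' / α := by
    have := pow_le_pow_left₀ hε0.le hε2.le 2
    rwa [Real.sq_sqrt (by positivity)] at this
  obtain ⟨m1, m2⟩ := main α hα ε hε0
  constructor
  · refine le_trans (ENNReal.ofReal_le_ofReal ?_) m1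
    have hδ : 0 < Real.exp ε - 1 := hε0.trans_le hlow
    calc C₁ (ω l) w' / 4 * (α⁻¹ * (ε ^ 2)⁻¹) = C₁ (ω l) w' / (α * (2 * ε) ^ 2) := by
          field_simp; norm_num
      _ ≤ _ := by gcongr
  · refine (ENat.toENNReal_le.mpr m2).trans ?_
    rw [ENat.toENNReal_coe, ← ENNReal.ofReal_natCast]
    refine ENNReal.ofReal_le_ofReal ((Nat.ceil_lt_add_one (by positivity)).le.trans ?_)
    have e1 : C₂ w' * (Real.exp ε + 1) ^ 2 / (α * (Real.exp ε - 1) ^ 2) ≤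
        C₂ w' * 4 ^ 2 / (α * ε ^ 2) := by
      gcongr
      linarith
    have e2 : 1 ≤ C₂ w' / (α * ε ^ 2) := by
      rw [le_div_iff₀ (by positivity)] at hε2' ⊢
      linarith
    calc _ ≤ C₂ w' * 4 ^ 2 / (α * ε ^ 2) + C₂ w' / (α * ε ^ 2) := add_le_add e1 e2
      _ = _ := by field_simp; ring
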